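/- **Setting.** Consider $N$ followers with Euler–Lagrange dynamics $$M_i(q_i)\ddot q_i+C_i(q_i,\dot q_i)\dot q_i+G_i(q_i)=\tau_i,\qquad q_i\in\mathbb R^n,\ i=1,\dots,N,$$ where $M_i$ is $C^1$, symmetric and uniformly positive definite ($x^TM_i(q)x\ge c_i|x|^2$ for some $c_i>0$ and all $q,x$), $C_i,G_i$ are locally Lipschitz, $\dot M_i(q_i)-2C_i(q_i,\dot q_i)$ is skew-symmetric, and, for a known locally Lipschitz matrix function $Y_i$ and an unknown constant vector $\Theta_i\in\mathbb R^p$, $M_i(q)a+C_i(q,u)b+G_i(q)=Y_i(q,u,a,b)\Theta_i$ for all $q,u,a,b\in\mathbb R^n$. The leader is $$\dot v=Sv,\qquad q_0=Cv,\qquad v\in\mathbb R^m,$$ where all eigenvalues of the real matrix $S$ are semisimple with zero real part. Communication is described by a digraph on $\{0,1,\dots,N\}$ (node $0$ is the leader) which contains a spanning tree rooted at $0$, i.e. every node is reachable from $0$, and whose subgraph on $\{1,\dots,N\}$ is undirected; $\bar{\mathcal N}_i=\{j:(j,i)\text{ is an edge}\}$. **Normal form.** For $z\in\mathbb R^l$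 and $x\in\mathbb R^{m_0+2l}$, $x=(x_0,x_1,\dots,x_{2l})$ with $x_0\in\mathbb R^{m_0}$, let $$S(z)=\begin{bmatrix}0_{m_0\times m_0}&0\\0&\operatorname{diag}(z)\otimes a\end{bmatrix},\quad a=\begin{bmatrix}0&1\\-1&0\end{bmatrix},$$ and let $\phi(x)\in\mathbb R^{l\times(m_0+2l)}$ be the matrix with $\phi(x)y=\operatorname{col}(x_1y_2-x_2y_1,\dots,x_{2l-1}y_{2l}-x_{2l}y_{2l-1})$ for all $y$. **Control law.** Let $w=Pv$ be coordinates of the leader with $PSP^{-1}=S(\omega)$ for an unknown $\omega\in\mathbb R^l$, and put $\hat C=CP^{-1}$, so $\dot w=S(\omega)w$ and $q_0=\hat Cw$ (if the leader is given in normal form, then $P=I$). With $\eta_0=w$, $e_{vi}=\sum_{j\in\bar{\mathcal N}_i}(\eta_j-\eta_i)$, positive numbers $\alpha,\mu_1,\mu_2$, positive definite $K_i$ and diagonal $\Lambda_i$ with positive diagonal entries, let $$\dot q_{ri}=\hat CS(\omega_i)\eta_i-\alpha(q_i-\hat C\eta_i),\quad s_i=\dot q_i-\dot q_{ri},\quad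 \ddot q_{ri}=\hat CS(\omega_i)\dot\eta_i+\hat CS(\dot\omega_i)\eta_i-\alpha(\dot q_i-\hat C\dot\eta_i),$$ and, with $Y_i=Y_i(q_i,\dot q_i,\ddot q_{ri},\dot q_{ri})$, $$\tau_i=-K_is_i+Y_i\hat\Theta_i,\qquad \dot{\hat\Theta}_i=-\Lambda_i^{-1}Y_i^Ts_i,\qquad \dot\eta_i=S(\omega_i)\eta_i+\mu_1e_{vi},\qquad \dot\omega_i=\mu_2\,\phi(e_{vi})\eta_i .$$ Here $\dot\eta_i,\dot\omega_i$ in $\ddot q_{ri}$ stand for the right-hand sides of the last two equations. **Theorem.** Coordinates $w=Pv$ with $PSP^{-1}=S(\omega)$, and all entries of $\omega$ positive, exist for suitable $m_0,l\ge 0$ with $m_0+2l=m$. In any coordinates with $PSP^{-1}=S(\omega)$, $\omega\in\mathbb R^l$, for all design parameters as above and all initial values $v(0),q_i(0),\dot q_i(0),\hat\Theta_i(0),\eta_i(0),\omega_i(0)$, the closed-loop system has a unique solution; it exists on $[0,\infty)$, the signals $v,q_i,\dot q_i,\hat\Theta_i,\eta_i,\omega_i,\tau_i$ are bounded on $[0,\infty)$,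 and for every $i=1,\dots,N$ $$\lim_{t\to\infty}(q_i(t)-q_0(t))=0,\qquad \lim_{t\to\infty}(\dot q_i(t)-\dot q_0(t))=0.$$ -/

import Mathlib

open Filter Topology Set
open scoped Matrix Kronecker

noncomputable section

/-! ### The leader system -/

/-- Every eigenvalue of the real matrix `S` (computed over `ℂ`) has zero real part and is
semisimple, i.e. its generalized eigenspace coincides with its eigenspace. -/
def NeutrallyStable {m : ℕ} (S : Matrix (Fin m) (Fin m) ℝ) : Prop :=
  ∀ μ : ℂ, Module.End.HasEigenvalue (Matrix.toLin' (S.map Complex.ofReal)) μ →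
    μ.re = 0 ∧
      Module.End.maxGenEigenspace (Matrix.toLin' (S.map Complex.ofReal)) μ =
        Module.End.eigenspace (Matrix.toLin' (S.map Complex.ofReal)) μ

/-- Coordinates of `ℝ ^ (m₀ + 2 l)`: first `m₀` constant modes, then `l` pairs. The pair
`(2k - 1, 2k)` of the usual numbering is `Sum.inr (k, 0)`, `Sum.inr (k, 1)`. -/
abbrev LeaderIdx (m₀ l : ℕ) : Type := Fin m₀ ⊕ (Fin l × Fin 2)

/-- `S(ω) = block diag (0, diag(ω) ⊗ a)` with `a = [0 1; -1 0]`. -/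
def leaderMatrix (m₀ : ℕ) {l : ℕ} (ω : Fin l → ℝ) :
    Matrix (LeaderIdx m₀ l) (LeaderIdx m₀ l) ℝ :=
  Matrix.fromBlocks 0 0 0 (Matrix.diagonal ω ⊗ₖ !![0, 1; -1, 0])

/-- The matrix `φ(x)`: row `k` has entries `-x₂ₖ, x₂ₖ₋₁` in the columns `2k - 1, 2k` of the
`k`-th pair and zeros elsewhere. -/
def phi {m₀ l : ℕ} (x : LeaderIdx m₀ l → ℝ) : Matrix (Fin l) (LeaderIdx m₀ l) ℝ :=
  Matrix.of fun k j =>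
    match j with
    | Sum.inl _ => 0
    | Sum.inr (k', c) =>
        if k = k' then (if c = 0 then -x (Sum.inr (k, 1)) else x (Sum.inr (k, 0))) else 0

/-- The linear change of coordinates `w = P v`, with inverse `R`, brings `v' = S v` to
`w' = S(ω) w`. -/
structure IsNormalForm {m m₀ l : ℕ} (S : Matrix (Fin m) (Fin m) ℝ) (ω : Fin l → ℝ)
    (P : Matrix (LeaderIdx m₀ l) (Fin m) ℝ) (R : Matrix (Fin m) (LeaderIdx m₀ l) ℝ) : Prop where
  left_inv : R * P = 1
  right_inv : P * R = 1
  conj : P * S * R = leaderMatrix m₀ ω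

/-! ### The communication graph

Node `0` is the leader, node `i.succ` is follower `i`; `G.Adj j i` says that `(j, i)` is an edge,
i.e. agent `i` receives information from agent `j`. -/

/-- There is a spanning tree rooted at the leader: every node is reachable from node `0`. -/
def HasLeaderSpanningTree {N : ℕ} (G : Digraph (Fin (N + 1))) : Prop :=
  ∀ i : Fin (N + 1), Relation.ReflTransGen G.Adj 0 i

/-- The subgraph of the followers is undirected. -/
def FollowersUndirected {N : ℕ} (G : Digraph (Fin (N + 1))) : Prop :=
  ∀ i j : Fin N, G.Adj i.succ j.succ → G.Adj j.succ i.succ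

open Classical in
/-- `e_{vi} = ∑_{j ∈ N̄ᵢ} (ηⱼ - ηᵢ)` with `η₀ = w`. -/
def neighborError {N m₀ l : ℕ} (G : Digraph (Fin (N + 1))) (w : LeaderIdx m₀ l → ℝ)
    (η : Fin N → LeaderIdx m₀ l → ℝ) (i : Fin N) : LeaderIdx m₀ l → ℝ :=
  ∑ j : Fin (N + 1) with G.Adj j i.succ,
    ((Fin.cons w η : Fin (N + 1) → LeaderIdx m₀ l → ℝ) j - η i)

/-! ### Euler–Lagrange systems -/

/-- The derivative of `M(q(t))` along a motion with position `q` and velocity `u`. -/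
def inertiaDot {n : ℕ} (M : (Fin n → ℝ) → Matrix (Fin n) (Fin n) ℝ) (q u : Fin n → ℝ) :
    Matrix (Fin n) (Fin n) ℝ :=
  Matrix.of fun a b => fderiv ℝ (fun x => M x a b) q u

/-- The system `M(q) q'' + C(q, q') q' + G(q) = τ`: `M` symmetric and uniformly positive
definite, `M' - 2 C` skew symmetric, `M` continuously differentiable, `C` and `G` locally
Lipschitz. -/
structure EulerLagrangeSystem (n : ℕ) where
  M : (Fin n → ℝ) → Matrix (Fin n) (Fin n) ℝ
  C : (Fin n → ℝ) → (Fin n → ℝ) → Matrix (Fin n) (Fin n) ℝ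
  G : (Fin n → ℝ) → Fin n → ℝ
  inertia_symm : ∀ q, (M q).IsSymm
  inertia_pos : ∃ c : ℝ, 0 < c ∧ ∀ q x : Fin n → ℝ, c * (x ⬝ᵥ x) ≤ x ⬝ᵥ (M q *ᵥ x)
  skew : ∀ q u : Fin n → ℝ,
    (inertiaDot M q u - (2 : ℝ) • C q u)ᵀ = -(inertiaDot M q u - (2 : ℝ) • C q u)
  inertia_contDiff : ∀ a b, ContDiff ℝ 1 fun q => M q a b
  coriolis_lipschitz : ∀ a b,
    LocallyLipschitz fun z : (Fin n → ℝ) × (Fin n → ℝ) => C z.1 z.2 a b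
  gravity_lipschitz : LocallyLipschitz G

/-- `Y(q, q', a, b)`, the known regression matrix. -/
abbrev RegressorFun (n p : ℕ) : Type :=
  (Fin n → ℝ) → (Fin n → ℝ) → (Fin n → ℝ) → (Fin n → ℝ) → Matrix (Fin n) (Fin p) ℝ

/-- `M(q) a + C(q, q') b + G(q) = Y(q, q', a, b) Θ` for all arguments, with `Y` locally
Lipschitz. -/
structure IsRegressor {n p : ℕ} (sys : EulerLagrangeSystem n) (Y : RegressorFun n p)
    (Θ : Fin p → ℝ) : Prop where
  eq : ∀ q u a b : Fin n → ℝ, sys.M q *ᵥ a + sys.C q u *ᵥ b + sys.G q = Y q u a b *ᵥ Θ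
  lipschitz : ∀ r c, LocallyLipschitz
    fun z : (Fin n → ℝ) × (Fin n → ℝ) × (Fin n → ℝ) × (Fin n → ℝ) =>
      Y z.1 z.2.1 z.2.2.1 z.2.2.2 r c

/-! ### The adaptive distributed control law

All functions below use only the follower's own state, its own design parameters, the output
matrix `C`, the regression matrix `Y`, and the neighbour sum `e`. The unknown frequencies of the
leader and the unknown parameters `Θ` do not enter. -/

/-- State of one follower with its controller: position `q`, velocity `dq`, parameter estimate
`Θhat`, estimate `η` of the leader's state, estimate `ω` of its frequencies. -/
@[ext]
structure AgentState (n p m₀ l : ℕ) where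
  q : Fin n → ℝ
  dq : Fin n → ℝ
  Θhat : Fin p → ℝ
  η : LeaderIdx m₀ l → ℝ
  ω : Fin l → ℝ

/-- Design parameters; the matrix `Λᵢ` is the diagonal matrix with diagonal `Λ i`. -/
structure Gains (N n p : ℕ) where
  α : ℝ
  μ₁ : ℝ
  μ₂ : ℝ
  K : Fin N → Matrix (Fin n) (Fin n) ℝ
  Λ : Fin N → Fin p → ℝ
  α_pos : 0 < α
  μ₁_pos : 0 < μ₁
  μ₂_pos : 0 < μ₂
  K_pos : ∀ i, (K i).PosDef
  Λ_pos : ∀ i k, 0 < Λ i k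

namespace ControlLaw

/-- `η' = S(ω) η + μ₁ e`. -/
def etaRate {n p m₀ l : ℕ} (μ₁ : ℝ) (z : AgentState n p m₀ l) (e : LeaderIdx m₀ l → ℝ) :
    LeaderIdx m₀ l → ℝ :=
  leaderMatrix m₀ z.ω *ᵥ z.η + μ₁ • e

/-- `ω' = μ₂ φ(e) η`. -/
def omegaRate {n p m₀ l : ℕ} (μ₂ : ℝ) (z : AgentState n p m₀ l) (e : LeaderIdx m₀ l → ℝ) :
    Fin l → ℝ :=
  μ₂ • (phi e *ᵥ z.η)

/-- `q_r' = C S(ω) η - α (q - C η)`. -/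
def refVel {n p m₀ l : ℕ} (C : Matrix (Fin n) (LeaderIdx m₀ l) ℝ) (α : ℝ)
    (z : AgentState n p m₀ l) : Fin n → ℝ :=
  C *ᵥ (leaderMatrix m₀ z.ω *ᵥ z.η) - α • (z.q - C *ᵥ z.η)

/-- `q_r'' = C S(ω) η' + C S(ω') η - α (q' - C η')`. -/
def refAcc {n p m₀ l : ℕ} (C : Matrix (Fin n) (LeaderIdx m₀ l) ℝ) (α μ₁ μ₂ : ℝ)
    (z : AgentState n p m₀ l) (e : LeaderIdx m₀ l → ℝ) : Fin n → ℝ :=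
  C *ᵥ (leaderMatrix m₀ z.ω *ᵥ etaRate μ₁ z e)
    + C *ᵥ (leaderMatrix m₀ (omegaRate μ₂ z e) *ᵥ z.η)
    - α • (z.dq - C *ᵥ etaRate μ₁ z e)

/-- `s = q' - q_r'`. -/
def slide {n p m₀ l : ℕ} (C : Matrix (Fin n) (LeaderIdx m₀ l) ℝ) (α : ℝ)
    (z : AgentState n p m₀ l) : Fin n → ℝ :=
  z.dq - refVel C α z

/-- The regression matrix at `(q, q', q_r'', q_r')`. -/
def regressor {n p m₀ l : ℕ} (Y : RegressorFun n p) (C : Matrix (Fin n) (LeaderIdx m₀ l) ℝ)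
    (α μ₁ μ₂ : ℝ) (z : AgentState n p m₀ l) (e : LeaderIdx m₀ l → ℝ) :
    Matrix (Fin n) (Fin p) ℝ :=
  Y z.q z.dq (refAcc C α μ₁ μ₂ z e) (refVel C α z)

/-- `τ = -K s + Y Θhat` for follower `i`. -/
def torque {N n p m₀ l : ℕ} (g : Gains N n p) (i : Fin N) (Y : RegressorFun n p)
    (C : Matrix (Fin n) (LeaderIdx m₀ l) ℝ) (z : AgentState n p m₀ l)
    (e : LeaderIdx m₀ l → ℝ) : Fin n → ℝ :=
  -(g.K i *ᵥ slide C g.α z) + regressor Y C g.α g.μ₁ g.μ₂ z e *ᵥ z.Θhat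

/-- `Θhat' = -Λ⁻¹ Yᵀ s` for follower `i`. -/
def thetaRate {N n p m₀ l : ℕ} (g : Gains N n p) (i : Fin N) (Y : RegressorFun n p)
    (C : Matrix (Fin n) (LeaderIdx m₀ l) ℝ) (z : AgentState n p m₀ l)
    (e : LeaderIdx m₀ l → ℝ) : Fin p → ℝ :=
  -((Matrix.diagonal (g.Λ i))⁻¹ *ᵥ ((regressor Y C g.α g.μ₁ g.μ₂ z e)ᵀ *ᵥ slide C g.α z))

end ControlLaw

/-- `v` and `x` satisfy, on the interval `J`, the leader equation `v' = S v`, the followers'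
Euler–Lagrange equations and the control law, where the agents receive the leader's state in the
coordinates `w = P v`, in which the leader's output is `q₀ = C R w`. -/
structure IsClosedLoopSolution {N n m p m₀ l : ℕ} (G : Digraph (Fin (N + 1)))
    (S : Matrix (Fin m) (Fin m) ℝ) (C : Matrix (Fin n) (Fin m) ℝ)
    (P : Matrix (LeaderIdx m₀ l) (Fin m) ℝ) (R : Matrix (Fin m) (LeaderIdx m₀ l) ℝ)
    (sys : Fin N → EulerLagrangeSystem n) (Y : Fin N → RegressorFun n p) (g : Gains N n p)
    (J : Set ℝ) (v : ℝ → Fin m → ℝ) (x : ℝ → Fin N → AgentState n p m₀ l) : Prop where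
  leader : ∀ t ∈ J, HasDerivWithinAt v (S *ᵥ v t) J t
  position : ∀ i, ∀ t ∈ J, HasDerivWithinAt (fun s => (x s i).q) (x t i).dq J t
  dynamics : ∀ i, ∀ t ∈ J, ∃ acc : Fin n → ℝ,
    HasDerivWithinAt (fun s => (x s i).dq) acc J t ∧
    (sys i).M (x t i).q *ᵥ acc + (sys i).C (x t i).q (x t i).dq *ᵥ (x t i).dq
        + (sys i).G (x t i).q
      = ControlLaw.torque g i (Y i) (C * R) (x t i)
          (neighborError G (P *ᵥ v t) (fun j => (x t j).η) i)
  theta : ∀ i, ∀ t ∈ J, HasDerivWithinAt (fun s => (x s i).Θhat)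
    (ControlLaw.thetaRate g i (Y i) (C * R) (x t i)
      (neighborError G (P *ᵥ v t) (fun j => (x t j).η) i)) J t
  eta : ∀ i, ∀ t ∈ J, HasDerivWithinAt (fun s => (x s i).η)
    (ControlLaw.etaRate g.μ₁ (x t i)
      (neighborError G (P *ᵥ v t) (fun j => (x t j).η) i)) J t
  omega : ∀ i, ∀ t ∈ J, HasDerivWithinAt (fun s => (x s i).ω)
    (ControlLaw.omegaRate g.μ₂ (x t i)
      (neighborError G (P *ᵥ v t) (fun j => (x t j).η) i)) J t

/-- `f` is bounded on `[0, ∞)`. -/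
def BoundedOnHalfLine {E : Type*} [Norm E] (f : ℝ → E) : Prop :=
  ∃ B : ℝ, ∀ t : ℝ, 0 ≤ t → ‖f t‖ ≤ B

end

/-!
The closed loop is a cascade of three parts, each with its own reason for convergence.

*The distributed observer.* Let `ξᵢ = ηᵢ - w` and let `eᵢ` be the neighbour errors. Since the graph
of the followers is undirected, `ξ ↦ -e` is symmetric, and it is positive definite because the
leader reaches every follower (`HasLeaderSpanningTree.exists_pos_mul_norm_sq_le`). The function
`-∑ ξᵢ ⬝ eᵢ + μ₂⁻¹ ∑ |ωᵢ - ω|²` has the derivative `-2 μ₁ ∑ |eᵢ|²`: the rotation `S(ω)` is skew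
symmetric and commutes with the coupling, and the frequency errors cancel because `S` and `φ` are
adjoint to each other (`dotProduct_leaderMatrix_mulVec`).

*Adaptive tracking.* With the sliding variable `s` and the parameter error `θ` of a follower, the
function `s ⬝ M s + θ ⬝ Λ θ` has the derivative `-2 s ⬝ K s`, because `M' - 2 C` is skew symmetric
and the adaptation law cancels the term `s ⬝ Y θ`.

*A stable linear filter.* The output error `y = q - C η` satisfies `y' = -α y + (s - μ₁ C e)`.

The two Lyapunov functions and the filter bound the state by a constant that depends only on the
initial values (`exists_bound_flatCurve`). The right-hand side of the closed loop is locally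
Lipschitz, so this a priori bound gives a unique solution on `[0, ∞)`
(`LocallyLipschitz.exists_global_solution`): the vector field is truncated outside a large ball, and
the bound shows that the solution of the truncated equation never leaves the ball.

Barbalat's lemma, in the form that a convergent quantity whose derivative is a continuous function
of the bounded state has a derivative tending to zero (`tendsto_zero_of_hasDerivWithinAt_comp`), now
yields `e → 0` and `s → 0` from the Lyapunov functions; hence `ξ → 0`, and, by the same lemma,
`ξ' → 0`. The filter then gives `y → 0` and `y' → 0`. The claims follow from
`q - q₀ = y + C ξ` and its derivative.

The normal form of the leader exists because a polynomial `X ∏ (X² + a²)` with distinct frequencies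
`a > 0` annihilates `S`; this is seen on the complex eigenspaces, which span. The kernels of the
coprime factors decompose the space, and on the kernel of `X² + a²` the operator `-S / a` is a
complex structure, so that a complex basis splits into rotated pairs (`exists_modes_basis`).
-/

/-! ### Ordinary differential equations with locally Lipschitz right-hand side -/

/-- The radial retraction of a normed space onto the closed ball of radius `L` is Lipschitz. -/
theorem exists_lipschitz_retraction_closedBall {E : Type*} [NormedAddCommGroup E]
    [NormedSpace ℝ E] {L : ℝ} (hL : 0 < L) :
    ∃ r : E → E, LipschitzWith 2 r ∧ (∀ y, ‖r y‖ ≤ L) ∧ ∀ y, ‖y‖ ≤ L → r y = y := by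
  refine ⟨fun y => (L / max L ‖y‖) • y, ?_, fun y => ?_, fun y hy => ?_⟩
  · refine LipschitzWith.of_dist_le_mul fun y z => ?_
    rw [dist_eq_norm, dist_eq_norm]
    set a := max L ‖y‖ with ha
    set b := max L ‖z‖ with hb
    have haL : L ≤ a := le_max_left _ _
    have hbL : L ≤ b := le_max_left _ _
    have hbz : ‖z‖ ≤ b := le_max_right _ _
    have ha0 : 0 < a := hL.trans_le haL
    have hb0 : 0 < b := hL.trans_le hbL
    have hab : |b - a| ≤ ‖y - z‖ := by
      have h1 := abs_max_sub_max_le_max L ‖z‖ L ‖y‖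
      rw [sub_self, abs_zero, max_eq_right (abs_nonneg (‖z‖ - ‖y‖))] at h1
      exact h1.trans ((abs_norm_sub_norm_le z y).trans (norm_sub_rev z y).le)
    have e : (L / a) • y - (L / b) • z = (L / a) • (y - z) + (L / a - L / b) • z := by
      rw [smul_sub, sub_smul]; abel
    have h1 : ‖(L / a) • (y - z)‖ ≤ ‖y - z‖ := by
      rw [norm_smul, Real.norm_eq_abs, abs_of_pos (by positivity)]
      exact mul_le_of_le_one_left (norm_nonneg _) ((div_le_one ha0).2 haL)
    have h2 : ‖(L / a - L / b) • z‖ ≤ ‖y - z‖ := by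
      have e2 : L / a - L / b = L / a * ((b - a) / b) := by field_simp
      rw [norm_smul, Real.norm_eq_abs, e2, abs_mul, abs_of_pos (div_pos hL ha0),
        abs_div, abs_of_pos hb0]
      calc L / a * (|b - a| / b) * ‖z‖ ≤ 1 * (|b - a| / b) * b := by
            gcongr
            exact (div_le_one ha0).2 haL
        _ = |b - a| := by field_simp
        _ ≤ _ := hab
    rw [e]
    calc _ ≤ ‖y - z‖ + ‖y - z‖ := (norm_add_le _ _).trans (add_le_add h1 h2)
      _ = _ := by simp; ring
  · have hm : 0 < max L ‖y‖ := hL.trans_le (le_max_left _ _)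
    rw [norm_smul, Real.norm_eq_abs, abs_of_pos (div_pos hL hm), div_mul_eq_mul_div,
      div_le_iff₀ hm]
    exact mul_le_mul_of_nonneg_left (le_max_right _ _) hL.le
  · simp only [max_eq_left hy, div_self hL.ne', one_smul]

theorem hasDerivWithinAt_Ici_of_Ico {E : Type*} [NormedAddCommGroup E]
    [NormedSpace ℝ E] {x : ℝ → E} {x' : E} {t T : ℝ} (ht : t ∈ Ico 0 T)
    (h : HasDerivWithinAt x x' (Ico 0 T) t) : HasDerivWithinAt x x' (Ici t) t :=
  (h.mono (Ico_subset_Ico_left ht.1)).mono_of_mem_nhdsWithin (Ico_mem_nhdsGE ht.2)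

section ODE

variable {E : Type*} [NormedAddCommGroup E] [NormedSpace ℝ E] [FiniteDimensional ℝ E]

/-- Truncating the vector field outside a ball does not affect a solution that is known a priori
to stay in a smaller ball; the truncated field is bounded and Lipschitz, so that one application
of the Picard–Lindelöf theorem covers `[0, T]`. -/
theorem LocallyLipschitz.exists_solution_Icc {f : E → E} (hf : LocallyLipschitz f) (x₀ : E)
    {B : ℝ} (hB : ∀ T : ℝ, 0 < T → ∀ x : ℝ → E, x 0 = x₀ →
      (∀ t ∈ Ico 0 T, HasDerivWithinAt x (f (x t)) (Ico 0 T) t) → ∀ t ∈ Ico 0 T, ‖x t‖ ≤ B)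
    {T : ℝ} (hT : 0 < T) :
    ∃ x : ℝ → E, x 0 = x₀ ∧ ∀ t ∈ Icc 0 T, HasDerivWithinAt x (f (x t)) (Icc 0 T) t := by
  have : ProperSpace E := FiniteDimensional.proper ℝ E
  have : CompleteSpace E := FiniteDimensional.complete ℝ E
  set R := max B ‖x₀‖ + 1 with hR
  have hcpt : IsCompact (Metric.closedBall (0 : E) R) := isCompact_closedBall _ _
  obtain ⟨K, hK⟩ := hf.locallyLipschitzOn.exists_lipschitzOnWith_of_compact hcpt
  obtain ⟨h, hh, hfh⟩ := hK.extend_finite_dimension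
  obtain ⟨L₀, hL₀⟩ := hcpt.exists_bound_of_continuousOn hf.continuous.continuousOn
  set L := max L₀ 1 with hL
  have hL1 : 0 < L := lt_of_lt_of_le one_pos (le_max_right _ _)
  obtain ⟨r, hr, hrb, hri⟩ := exists_lipschitz_retraction_closedBall (E := E) hL1
  set g : E → E := fun x => r (h x) with hg
  have hgf : ∀ x : E, ‖x‖ ≤ R → g x = f x := by
    intro x hx
    have hx' : x ∈ Metric.closedBall (0 : E) R := by simpa using hx
    rw [hg]
    simp only
    rw [← hfh hx']
    exact hri _ ((hL₀ x hx').trans (le_max_left _ _))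
  have hgl := hr.comp hh
  have hPL : IsPicardLindelof (fun _ => g) (⟨0, by simp [hT.le]⟩ : Icc (0 : ℝ) T) x₀
      (⟨L * T, by positivity⟩ : NNReal) 0 (⟨L, hL1.le⟩ : NNReal) _ :=
    IsPicardLindelof.of_time_independent (fun x _ => hrb _) (hgl.lipschitzOnWith) (by
      simp only [NNReal.coe_zero, sub_zero, sub_self]
      rw [max_eq_left hT.le]
      exact le_rfl)
  obtain ⟨x, hx0, hx⟩ := hPL.exists_eq_forall_mem_Icc_hasDerivWithinAt₀
  simp only at hx0 hx
  have hxc : ContinuousOn x (Icc 0 T) := fun t ht => (hx t ht).continuousWithinAt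
  -- the first time at which the norm reaches `R` cannot exist
  have key : ∀ t ∈ Icc 0 T, ‖x t‖ < R := by
    by_contra hcon
    push Not at hcon
    obtain ⟨t₂, ht₂, hRt₂⟩ := hcon
    have hcl : IsCompact (Icc 0 T ∩ (fun t => ‖x t‖) ⁻¹' Ici R) :=
      isCompact_Icc.of_isClosed_subset (hxc.norm.preimage_isClosed_of_isClosed isClosed_Icc
        isClosed_Ici) inter_subset_left
    obtain ⟨t₁, ⟨ht₁, hRt₁⟩, hmin⟩ := hcl.exists_isLeast ⟨t₂, ht₂, hRt₂⟩
    have hRt₁' : R ≤ ‖x t₁‖ := hRt₁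
    have ht₁pos : 0 < t₁ := by
      rcases ht₁.1.eq_or_lt with h0 | h0
      · rw [← h0, hx0] at hRt₁'
        have := le_max_right B ‖x₀‖
        linarith
      · exact h0
    have hsub : Ico 0 t₁ ⊆ Icc 0 T := fun t ht => ⟨ht.1, ht.2.le.trans ht₁.2⟩
    have hlt : ∀ t ∈ Ico 0 t₁, ‖x t‖ < R := by
      intro t ht
      by_contra hc
      exact absurd (hmin ⟨hsub ht, not_lt.1 hc⟩) (not_le.2 ht.2)
    have hb := hB t₁ ht₁pos x hx0 fun t ht => by
      rw [← hgf _ (hlt t ht).le]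
      exact (hx t (hsub ht)).mono hsub
    have hcw : ContinuousWithinAt (fun t => ‖x t‖) (Ico 0 t₁) t₁ :=
      ((hxc t₁ ht₁).mono hsub).norm
    have hmem : t₁ ∈ closure (Ico 0 t₁) := by
      rw [closure_Ico ht₁pos.ne]; exact ⟨ht₁pos.le, le_rfl⟩
    have := hcw.closure_le hmem continuousWithinAt_const hb
    have := le_max_left B ‖x₀‖
    linarith
  exact ⟨x, hx0, fun t ht => hgf _ (key t ht).le ▸ hx t ht⟩

theorem LocallyLipschitz.solution_unique {f : E → E} (hf : LocallyLipschitz f) {T : ℝ}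
    {x y : ℝ → E} (h0 : x 0 = y 0)
    (hx : ∀ t ∈ Ico 0 T, HasDerivWithinAt x (f (x t)) (Ico 0 T) t)
    (hy : ∀ t ∈ Ico 0 T, HasDerivWithinAt y (f (y t)) (Ico 0 T) t) : EqOn x y (Ico 0 T) := by
  have : ProperSpace E := FiniteDimensional.proper ℝ E
  intro t ht
  have hsub : Icc 0 t ⊆ Ico 0 T := fun s hs => ⟨hs.1, hs.2.trans_lt ht.2⟩
  have hsub' : Ico 0 t ⊆ Ico 0 T := Ico_subset_Icc_self.trans hsub
  have hxc : ContinuousOn x (Icc 0 t) := fun s hs =>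
    (hx s (hsub hs)).continuousWithinAt.mono hsub
  have hyc : ContinuousOn y (Icc 0 t) := fun s hs =>
    (hy s (hsub hs)).continuousWithinAt.mono hsub
  obtain ⟨B₁, hB₁⟩ := isCompact_Icc.exists_bound_of_continuousOn hxc
  obtain ⟨B₂, hB₂⟩ := isCompact_Icc.exists_bound_of_continuousOn hyc
  obtain ⟨K, hK⟩ := hf.locallyLipschitzOn.exists_lipschitzOnWith_of_compact
    (isCompact_closedBall (0 : E) (max B₁ B₂))
  refine ODE_solution_unique_of_mem_Icc_right (v := fun _ => f) (fun _ _ => hK) hxc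
    (fun s hs => hasDerivWithinAt_Ici_of_Ico (hsub' hs) (hx s (hsub' hs)))
    (fun s hs => ?_) hyc (fun s hs => hasDerivWithinAt_Ici_of_Ico (hsub' hs) (hy s (hsub' hs)))
    (fun s hs => ?_) h0 ⟨ht.1, le_rfl⟩
  · simpa using Or.inl (hB₁ s (Ico_subset_Icc_self hs))
  · simpa using Or.inr (hB₂ s (Ico_subset_Icc_self hs))

/-- Solutions with an a priori bound, uniform over the interval of existence, are global. -/
theorem LocallyLipschitz.exists_global_solution {f : E → E} (hf : LocallyLipschitz f) (x₀ : E)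
    {B : ℝ} (hB : ∀ T : ℝ, 0 < T → ∀ x : ℝ → E, x 0 = x₀ →
      (∀ t ∈ Ico 0 T, HasDerivWithinAt x (f (x t)) (Ico 0 T) t) → ∀ t ∈ Ico 0 T, ‖x t‖ ≤ B) :
    ∃ x : ℝ → E, x 0 = x₀ ∧ ∀ t ∈ Ici 0, HasDerivWithinAt x (f (x t)) (Ici 0) t := by
  have hex : ∀ k : ℕ, ∃ x : ℝ → E, x 0 = x₀ ∧
      ∀ t ∈ Ico (0 : ℝ) (k + 1), HasDerivWithinAt x (f (x t)) (Ico 0 (k + 1)) t := by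
    intro k
    obtain ⟨x, hx0, hx⟩ := hf.exists_solution_Icc x₀ hB (T := (k : ℝ) + 1) (by positivity)
    exact ⟨x, hx0, fun t ht => (hx t (Ico_subset_Icc_self ht)).mono Ico_subset_Icc_self⟩
  choose X hX0 hX using hex
  have hmono : ∀ j k : ℕ, j ≤ k → EqOn (X j) (X k) (Ico 0 (j + 1)) := by
    intro j k hjk
    have hsub : Ico (0 : ℝ) (j + 1) ⊆ Ico 0 (k + 1) := Ico_subset_Ico_right (by gcongr)
    exact hf.solution_unique ((hX0 j).trans (hX0 k).symm) (hX j) fun t ht =>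
      (hX k t (hsub ht)).mono hsub
  have heq : ∀ k : ℕ, EqOn (fun t => X ⌊t⌋₊ t) (X k) (Ico 0 (k + 1)) := by
    intro k t ht
    refine hmono _ _ ?_ ⟨ht.1, Nat.lt_floor_add_one t⟩
    have : ⌊t⌋₊ < k + 1 := (Nat.floor_lt ht.1).2 (by exact_mod_cast ht.2)
    omega
  refine ⟨fun t => X ⌊t⌋₊ t, by simp [hX0], fun t ht => ?_⟩
  have ht0 : (0 : ℝ) ≤ t := ht
  have htk : t ∈ Ico (0 : ℝ) (⌊t⌋₊ + 1) := ⟨ht0, Nat.lt_floor_add_one t⟩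
  have h1 : HasDerivWithinAt (fun t => X ⌊t⌋₊ t) (f (X ⌊t⌋₊ t)) (Ico 0 (⌊t⌋₊ + 1)) t :=
    (hX _ t htk).congr (fun s hs => heq _ hs) rfl
  refine h1.mono_of_mem_nhdsWithin ?_
  exact mem_nhdsWithin.2 ⟨Iio (⌊t⌋₊ + 1), isOpen_Iio, htk.2, fun s hs => ⟨hs.2, hs.1⟩⟩

end ODE

/-! ### Asymptotics on the half-line -/

/-- Barbalat's lemma: if `F` converges and its derivative is uniformly continuous, then the
derivative tends to zero. -/
theorem tendsto_zero_of_hasDerivWithinAt_of_uniformContinuousOn {F φ : ℝ → ℝ} {c : ℝ}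
    (hF : ∀ t ∈ Ici 0, HasDerivWithinAt F (φ t) (Ici 0) t) (hc : Tendsto F atTop (𝓝 c))
    (hφ : UniformContinuousOn φ (Ici 0)) : Tendsto φ atTop (𝓝 0) := by
  rw [Metric.tendsto_atTop]
  intro ε hε
  obtain ⟨δ, hδ, hu⟩ := Metric.uniformContinuousOn_iff.1 hφ (ε / 2) (by positivity)
  obtain ⟨T, hT⟩ := Metric.tendsto_atTop.1 hc (ε * δ / 16) (by positivity)
  refine ⟨max T 0, fun t ht => ?_⟩
  have hTt : T ≤ t := (le_max_left _ _).trans ht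
  have ht0 : 0 ≤ t := (le_max_right _ _).trans ht
  -- by the mean value theorem `F (t + δ / 2) - F t` is `δ / 2` times a value of `φ` near `φ t`
  obtain ⟨s, hs, hsF⟩ := exists_hasDerivAt_eq_slope F φ (show t < t + δ / 2 by linarith)
    (fun r hr => ((hF r (ht0.trans hr.1)).continuousWithinAt).mono
      fun u hu => ht0.trans hu.1)
    (fun r hr => (hF r (ht0.trans hr.1.le)).hasDerivAt (Ici_mem_nhds (ht0.trans_lt hr.1)))
  have h1 := hT t hTt
  have h2 := hT (t + δ / 2) (by linarith)
  have h3 := hu s (ht0.trans hs.1.le) t ht0 (by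
    rw [Real.dist_eq, abs_lt]; constructor <;> linarith [hs.1, hs.2])
  rw [Real.dist_eq, abs_lt] at h1 h2 h3
  have h4 : φ s * (δ / 2) = F (t + δ / 2) - F t := by
    rw [hsF, add_sub_cancel_left, div_mul_cancel₀ _ (by positivity)]
  rw [Real.dist_eq, sub_zero, abs_lt]
  have h5 : |φ s * (δ / 2)| < ε * δ / 8 := by rw [h4, abs_lt]; constructor <;> linarith
  rw [abs_mul, abs_of_pos (by positivity : 0 < δ / 2)] at h5
  have h6 : |φ s| < ε / 4 := by
    by_contra hc
    push Not at hc
    nlinarith [mul_le_mul_of_nonneg_right hc hδ.le]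
  rw [abs_lt] at h6
  constructor <;> linarith

/-- Barbalat's lemma along a bounded trajectory of an autonomous system: the uniform continuity of
the derivative is automatic if it is a continuous function of the state. -/
theorem tendsto_zero_of_hasDerivWithinAt_comp {E : Type*} [NormedAddCommGroup E]
    [NormedSpace ℝ E] [FiniteDimensional ℝ E] {f : E → E} (hf : Continuous f) {x : ℝ → E}
    (hx : ∀ t ∈ Ici 0, HasDerivWithinAt x (f (x t)) (Ici 0) t) {B : ℝ}
    (hB : ∀ t ∈ Ici (0 : ℝ), ‖x t‖ ≤ B) {F : ℝ → ℝ} {φ : E → ℝ} (hφ : Continuous φ) {c : ℝ}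
    (hF : ∀ t ∈ Ici 0, HasDerivWithinAt F (φ (x t)) (Ici 0) t) (hc : Tendsto F atTop (𝓝 c)) :
    Tendsto (fun t => φ (x t)) atTop (𝓝 0) := by
  have : ProperSpace E := FiniteDimensional.proper ℝ E
  have hcpt : IsCompact (Metric.closedBall (0 : E) B) := isCompact_closedBall _ _
  obtain ⟨L, hL⟩ := hcpt.exists_bound_of_continuousOn hf.continuousOn
  have hmem : MapsTo x (Ici 0) (Metric.closedBall (0 : E) B) := fun t ht => by
    simpa using hB t ht
  have hlip : LipschitzOnWith (Real.toNNReal L) x (Ici 0) :=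
    (convex_Ici 0).lipschitzOnWith_of_nnnorm_hasDerivWithin_le hx fun t ht => by
      rw [← NNReal.coe_le_coe, coe_nnnorm]
      exact (hL _ (hmem ht)).trans (Real.le_coe_toNNReal L)
  exact tendsto_zero_of_hasDerivWithinAt_of_uniformContinuousOn hF hc
    ((hcpt.uniformContinuousOn_of_continuous hφ.continuousOn).comp hlip.uniformContinuousOn hmem)

/-- A bound for `y' = -α y + b` from time `a` on. -/
theorem le_of_hasDerivWithinAt_linear {α β a : ℝ} (hα : 0 < α) {J : Set ℝ} (hJ : Convex ℝ J)
    (ha : a ∈ J) {y b : ℝ → ℝ}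
    (hy : ∀ t ∈ J, HasDerivWithinAt y (-α * y t + b t) J t) (hb : ∀ t ∈ J, a ≤ t → b t ≤ β)
    {t : ℝ} (ht : t ∈ J) (hat : a ≤ t) :
    y t ≤ β / α + Real.exp (-α * (t - a)) * (y a - β / α) := by
  have hJa : Convex ℝ (J ∩ Ici a) := hJ.inter (convex_Ici a)
  have hd : ∀ s ∈ J ∩ Ici a, HasDerivWithinAt (fun s => Real.exp (α * (s - a)) * (y s - β / α))
      (Real.exp (α * (s - a)) * (b s - β)) (J ∩ Ici a) s := by
    intro s hs
    have h1 : HasDerivWithinAt (fun s => Real.exp (α * (s - a)))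
        (Real.exp (α * (s - a)) * (α * 1)) (J ∩ Ici a) s :=
      (((hasDerivWithinAt_id s _).sub_const a).const_mul α).exp
    convert! h1.mul (((hy s hs.1).mono inter_subset_left).sub_const (β / α)) using 1
    field_simp
    ring
  have hanti := antitoneOn_of_hasDerivWithinAt_nonpos hJa
    (fun s hs => (hd s hs).continuousWithinAt)
    (fun s hs => (hd s (interior_subset hs)).mono interior_subset) (fun s hs =>
      mul_nonpos_of_nonneg_of_nonpos (Real.exp_pos _).le
        (sub_nonpos.2 (hb s (interior_subset hs).1 (interior_subset hs).2)))
  have h := hanti ⟨ha, le_refl a⟩ ⟨ht, hat⟩ hat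
  simp only [sub_self, mul_zero, Real.exp_zero, one_mul] at h
  have h2 : y t - β / α = Real.exp (-α * (t - a)) *
      (Real.exp (α * (t - a)) * (y t - β / α)) := by
    rw [← mul_assoc, ← Real.exp_add]; simp
  have h3 := mul_le_mul_of_nonneg_left h (Real.exp_pos (-α * (t - a))).le
  linarith

theorem abs_le_of_hasDerivWithinAt_linear {α β a : ℝ} (hα : 0 < α) {J : Set ℝ}
    (hJ : Convex ℝ J) (ha : a ∈ J) {y b : ℝ → ℝ}
    (hy : ∀ t ∈ J, HasDerivWithinAt y (-α * y t + b t) J t) (hb : ∀ t ∈ J, a ≤ t → |b t| ≤ β)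
    {t : ℝ} (ht : t ∈ J) (hat : a ≤ t) :
    |y t| ≤ β / α + Real.exp (-α * (t - a)) * |y a| := by
  have hβ : 0 ≤ β / α := div_nonneg ((abs_nonneg _).trans (hb a ha le_rfl)) hα.le
  have hexp := (Real.exp_pos (-α * (t - a))).le
  have h1 := le_of_hasDerivWithinAt_linear hα hJ ha hy
    (fun s hs hs' => (le_abs_self _).trans (hb s hs hs')) ht hat
  have h2 := le_of_hasDerivWithinAt_linear hα hJ ha (y := fun s => -y s) (b := fun s => -b s)
    (fun s hs => by convert! (hy s hs).neg using 1; ring)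
    (fun s hs hs' => (neg_le_abs _).trans (hb s hs hs')) ht hat
  have h3 := mul_le_mul_of_nonneg_left (le_abs_self (y a)) hexp
  have h4 := mul_le_mul_of_nonneg_left (neg_le_abs (y a)) hexp
  have h5 := mul_nonneg hexp hβ
  rw [abs_le]
  constructor <;> nlinarith

/-- A stable scalar linear filter maps inputs that vanish at infinity to such outputs. -/
theorem tendsto_zero_of_hasDerivWithinAt_linear {α : ℝ} (hα : 0 < α) {y b : ℝ → ℝ}
    (hy : ∀ t ∈ Ici 0, HasDerivWithinAt y (-α * y t + b t) (Ici 0) t)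
    (hb : Tendsto b atTop (𝓝 0)) : Tendsto y atTop (𝓝 0) := by
  rw [Metric.tendsto_atTop]
  intro ε hε
  obtain ⟨T, hT⟩ := Metric.tendsto_atTop.1 hb (α * ε / 2) (by positivity)
  set a := max T 0 with ha
  have ha0 : a ∈ Ici (0 : ℝ) := mem_Ici.2 (le_max_right _ _)
  have hlim : Tendsto (fun t => ε / 2 + Real.exp (-α * (t - a)) * |y a|) atTop (𝓝 (ε / 2)) := by
    have h1 : Tendsto (fun t : ℝ => -α * (t - a)) atTop atBot :=
      (tendsto_atTop_add_const_right atTop (-a) tendsto_id).const_mul_atTop_of_neg (by linarith)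
    simpa using ((Real.tendsto_exp_atBot.comp h1).mul_const |y a|).const_add (ε / 2)
  obtain ⟨T', hT'⟩ := (hlim.eventually (gt_mem_nhds (half_lt_self hε))).exists_forall_of_atTop
  refine ⟨max T' a, fun t ht => ?_⟩
  have hat : a ≤ t := (le_max_right _ _).trans ht
  have h := abs_le_of_hasDerivWithinAt_linear hα (convex_Ici 0) ha0 hy (β := α * ε / 2)
    (fun s _ hs => by
      have := hT s ((le_max_left _ _).trans hs)
      rw [Real.dist_eq, sub_zero] at this
      exact this.le) (le_trans ha0 hat : t ∈ Ici 0) hat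
  have h2 := hT' t ((le_max_left _ _).trans ht)
  rw [Real.dist_eq, sub_zero]
  have h3 : α * ε / 2 / α = ε / 2 := by field_simp
  rw [h3] at h
  exact h.trans_lt h2

/-- A function that is antitone on `[0, ∞)` and bounded below converges. -/
theorem AntitoneOn.exists_tendsto_atTop_of_bddBelow {F : ℝ → ℝ} (hF : AntitoneOn F (Ici 0))
    {b : ℝ} (hb : ∀ t ∈ Ici 0, b ≤ F t) : ∃ c, Tendsto F atTop (𝓝 c) := by
  have hanti : Antitone fun t => F (max t 0) := fun s t hst =>
    hF (mem_Ici.2 (le_max_right _ _)) (mem_Ici.2 (le_max_right _ _)) (max_le_max_right 0 hst)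
  refine ⟨_, (tendsto_atTop_ciInf hanti ⟨b, ?_⟩).congr' ?_⟩
  · rintro _ ⟨t, rfl⟩
    exact hb _ (mem_Ici.2 (le_max_right _ _))
  · filter_upwards [eventually_ge_atTop 0] with t ht
    simp [max_eq_left ht]

/-! ### Locally Lipschitz functions and matrices -/

section LocallyLipschitz

variable {X : Type*} [PseudoEMetricSpace X] {ι κ : Type*} [Fintype ι] [Fintype κ]

theorem LocallyLipschitz.pi {F : ι → Type*} [∀ i, PseudoEMetricSpace (F i)] {f : X → ∀ i, F i}
    (hf : ∀ i, LocallyLipschitz fun x => f x i) :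
    LocallyLipschitz f := by
  intro x
  choose K t ht h using fun i => hf i x
  refine ⟨Finset.univ.sup K, ⋂ i, t i, Filter.iInter_mem.2 ht, fun y hy z hz => ?_⟩
  rw [edist_pi_le_iff]
  intro i
  refine (h i (mem_iInter.1 hy i) (mem_iInter.1 hz i)).trans ?_
  gcongr
  exact Finset.le_sup (f := K) (Finset.mem_univ i)

theorem LocallyLipschitz.apply {f : X → ι → ℝ} (hf : LocallyLipschitz f) (i : ι) :
    LocallyLipschitz fun x => f x i :=
  (LipschitzWith.eval i).locallyLipschitz.comp hf

theorem LocallyLipschitz.mul_real {f g : X → ℝ} (hf : LocallyLipschitz f)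
    (hg : LocallyLipschitz g) : LocallyLipschitz fun x => f x * g x :=
  (ContDiff.locallyLipschitz (𝕂 := ℝ) (f := fun p : ℝ × ℝ => p.1 * p.2) (by fun_prop)).comp
    (hf.prodMk hg)

theorem LocallyLipschitz.finset_sum {σ : Type*} {F : Type*} [SeminormedAddCommGroup F]
    (s : Finset σ) {f : σ → X → F} (hf : ∀ i, LocallyLipschitz (f i)) :
    LocallyLipschitz fun x => ∑ i ∈ s, f i x := by
  classical
  induction s using Finset.induction_on with
  | empty => simpa using LocallyLipschitz.const (0 : F)
  | insert a s ha ih =>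
    simp only [Finset.sum_insert ha]
    exact (hf a).add ih

theorem LocallyLipschitz.smul_real {c : X → ℝ} {f : X → ι → ℝ} (hc : LocallyLipschitz c)
    (hf : LocallyLipschitz f) : LocallyLipschitz fun x => c x • f x :=
  .pi fun i => by simpa using hc.mul_real (hf.apply i)

theorem LocallyLipschitz.mulVec {A : X → Matrix ι κ ℝ}
    (hA : ∀ i j, LocallyLipschitz fun x => A x i j) {u : X → κ → ℝ} (hu : LocallyLipschitz u) :
    LocallyLipschitz fun x => A x *ᵥ u x :=
  .pi fun i => .finset_sum _ fun j => (hA i j).mul_real (hu.apply j)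

theorem LocallyLipschitz.const_mulVec (A : Matrix ι κ ℝ) {u : X → κ → ℝ}
    (hu : LocallyLipschitz u) : LocallyLipschitz fun x => A *ᵥ u x :=
  .mulVec (A := fun _ => A) (fun i j => .const (A i j)) hu

theorem LocallyLipschitz.neg_pi {f : X → ι → ℝ} (hf : LocallyLipschitz f) :
    LocallyLipschitz fun x => -f x := by
  simpa using (LocallyLipschitz.const (0 : ι → ℝ)).sub hf

end LocallyLipschitz

theorem Matrix.contDiff_inv_apply {E : Type*} [NormedAddCommGroup E] [NormedSpace ℝ E]
    {ι : Type*} [Fintype ι] [DecidableEq ι] {A : E → Matrix ι ι ℝ}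
    (hA : ∀ i j, ContDiff ℝ 1 fun x => A x i j) (h0 : ∀ x, IsUnit (A x)) (i j : ι) :
    ContDiff ℝ 1 fun x => (A x)⁻¹ i j := by
  have hdet : ∀ B : E → Matrix ι ι ℝ, (∀ i j, ContDiff ℝ 1 fun x => B x i j) →
      ContDiff ℝ 1 fun x => (B x).det := by
    intro B hB
    simp only [Matrix.det_apply']
    exact ContDiff.sum fun σ _ => contDiff_const.mul (contDiff_prod fun i _ => hB _ _)
  simp only [Matrix.inv_def, Matrix.smul_apply, Ring.inverse_eq_inv', smul_eq_mul,
    Matrix.adjugate_apply]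
  refine ((hdet A hA).inv fun x => ((Matrix.isUnit_iff_isUnit_det _).1 (h0 x)).ne_zero).mul
    (hdet _ fun a b => ?_)
  by_cases hab : a = j
  · subst hab
    simpa using contDiff_const
  · simpa [Matrix.updateRow_ne hab] using hA a b

/-! ### Derivatives of products along curves, and quadratic forms -/

section Deriv

variable {ι κ : Type*} {J : Set ℝ} {t : ℝ}

theorem HasDerivWithinAt.dotProduct [Fintype ι] {u w : ℝ → ι → ℝ} {u' w' : ι → ℝ}
    (hu : HasDerivWithinAt u u' J t) (hw : HasDerivWithinAt w w' J t) :
    HasDerivWithinAt (fun s => u s ⬝ᵥ w s) (u' ⬝ᵥ w t + u t ⬝ᵥ w') J t := by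
  rw [hasDerivWithinAt_pi] at hu hw
  simp only [_root_.dotProduct, ← Finset.sum_add_distrib]
  exact HasDerivWithinAt.fun_sum fun i _ => (hu i).mul (hw i)

theorem HasDerivWithinAt.mulVec [Finite ι] [Fintype κ] {A : ℝ → Matrix ι κ ℝ} {A' : Matrix ι κ ℝ}
    (hA : ∀ i j, HasDerivWithinAt (fun s => A s i j) (A' i j) J t) {u : ℝ → κ → ℝ}
    {u' : κ → ℝ} (hu : HasDerivWithinAt u u' J t) :
    HasDerivWithinAt (fun s => A s *ᵥ u s) (A' *ᵥ u t + A t *ᵥ u') J t := by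
  have := Fintype.ofFinite ι
  rw [hasDerivWithinAt_pi] at hu ⊢
  intro i
  simp only [Matrix.mulVec, _root_.dotProduct, Pi.add_apply, ← Finset.sum_add_distrib]
  exact HasDerivWithinAt.fun_sum fun j _ => (hA i j).mul (hu j)

theorem HasDerivWithinAt.const_mulVec [Finite ι] [Fintype κ] (A : Matrix ι κ ℝ) {u : ℝ → κ → ℝ}
    {u' : κ → ℝ} (hu : HasDerivWithinAt u u' J t) :
    HasDerivWithinAt (fun s => A *ᵥ u s) (A *ᵥ u') J t := by
  simpa using HasDerivWithinAt.mulVec (A := fun _ => A) (A' := 0)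
    (fun i j => hasDerivWithinAt_const _ _ _) hu

end Deriv

/-- A continuous, positive, quadratically homogeneous function dominates the squared norm. -/
theorem exists_pos_mul_norm_sq_le {E : Type*} [NormedAddCommGroup E] [NormedSpace ℝ E]
    [FiniteDimensional ℝ E] {Q : E → ℝ} (hQ : Continuous Q)
    (hsmul : ∀ (c : ℝ) x, Q (c • x) = c ^ 2 * Q x) (hpos : ∀ x, x ≠ 0 → 0 < Q x) :
    ∃ c : ℝ, 0 < c ∧ ∀ x, c * ‖x‖ ^ 2 ≤ Q x := by
  have : ProperSpace E := FiniteDimensional.proper ℝ E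
  have h0 : Q 0 = 0 := by simpa using hsmul 0 0
  rcases (Metric.sphere (0 : E) 1).eq_empty_or_nonempty with he | hne
  · refine ⟨1, one_pos, fun x => ?_⟩
    by_cases hx : x = 0
    · simp [hx, h0]
    · have : ‖x‖⁻¹ • x ∈ Metric.sphere (0 : E) 1 := by
        simp [norm_smul, norm_ne_zero_iff.2 hx]
      rw [he] at this
      exact this.elim
  · obtain ⟨y, hy, hmin⟩ := (isCompact_sphere (0 : E) 1).exists_isMinOn hne hQ.continuousOn
    have hy0 : y ≠ 0 := by
      rintro rfl
      simp at hy
    refine ⟨Q y, hpos y hy0, fun x => ?_⟩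
    by_cases hx : x = 0
    · simp [hx, h0]
    · have hx' : 0 < ‖x‖ := norm_pos_iff.2 hx
      have h1 : Q y ≤ Q (‖x‖⁻¹ • x) := hmin (by simp [norm_smul, norm_ne_zero_iff.2 hx])
      have h2 : Q x = ‖x‖ ^ 2 * Q (‖x‖⁻¹ • x) := by rw [hsmul]; field_simp
      rw [h2, mul_comm]
      gcongr

theorem Matrix.PosDef.exists_pos_mul_norm_sq_le {ι : Type*} [Fintype ι] {A : Matrix ι ι ℝ}
    (hA : A.PosDef) : ∃ c : ℝ, 0 < c ∧ ∀ x : ι → ℝ, c * ‖x‖ ^ 2 ≤ x ⬝ᵥ (A *ᵥ x) := by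
  refine _root_.exists_pos_mul_norm_sq_le (Q := fun x => x ⬝ᵥ (A *ᵥ x)) ?_ (fun c x => ?_)
    fun x hx => ?_
  · exact Continuous.dotProduct continuous_id (Continuous.matrix_mulVec continuous_const
      continuous_id)
  · simp only [Matrix.mulVec_smul, smul_dotProduct, dotProduct_smul, smul_eq_mul]; ring
  · simpa using hA.dotProduct_mulVec_pos hx

theorem norm_sq_le_dotProduct_self {ι : Type*} [Fintype ι] (x : ι → ℝ) : ‖x‖ ^ 2 ≤ x ⬝ᵥ x := by
  have h0 : 0 ≤ x ⬝ᵥ x := Finset.sum_nonneg fun i _ => mul_self_nonneg _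
  have h : ‖x‖ ≤ √(x ⬝ᵥ x) := by
    refine (pi_norm_le_iff_of_nonneg (Real.sqrt_nonneg _)).2 fun i => ?_
    rw [Real.norm_eq_abs]
    refine Real.abs_le_sqrt ?_
    rw [sq]
    exact Finset.single_le_sum (f := fun i => x i * x i) (fun i _ => mul_self_nonneg _)
      (Finset.mem_univ i)
  calc ‖x‖ ^ 2 ≤ √(x ⬝ᵥ x) ^ 2 := by gcongr
    _ = _ := Real.sq_sqrt h0

theorem dotProduct_mulVec_self_eq_zero_of_transpose_eq_neg {ι : Type*} [Fintype ι]
    {A : Matrix ι ι ℝ} (hA : Aᵀ = -A) (x : ι → ℝ) : x ⬝ᵥ (A *ᵥ x) = 0 := by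
  have h : x ⬝ᵥ (A *ᵥ x) = -(x ⬝ᵥ (A *ᵥ x)) := by
    conv_lhs => rw [Matrix.dotProduct_mulVec, ← Matrix.mulVec_transpose, hA, Matrix.neg_mulVec,
      neg_dotProduct, dotProduct_comm]
  linarith

/-! ### The normal form of a neutrally stable matrix -/

open Polynomial in
/-- The real polynomial `X ∏ (X² + a²)`, the product over a finite set of frequencies. -/
noncomputable def modesPoly (s : Finset ℝ) : ℝ[X] := X * ∏ a ∈ s, (X ^ 2 + C (a ^ 2))

open Polynomial in
/-- A real operator with `T² = -a²`, `a ≠ 0`, is multiplication by `-a i` for a complex structure on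
the space; a complex basis gives pairs of real basis vectors that `T` rotates. -/
theorem exists_basis_of_sq_eq_neg {V : Type} [AddCommGroup V] [Module ℝ V]
    [FiniteDimensional ℝ V] (T : V →ₗ[ℝ] V) {a : ℝ} (ha : a ≠ 0)
    (hT : ∀ x, T (T x) = -(a ^ 2 • x)) :
    ∃ (κ : Type) (_ : Fintype κ) (b : Module.Basis (κ × Fin 2) ℝ V),
      ∀ k, T (b (k, 0)) = -(a • b (k, 1)) ∧ T (b (k, 1)) = a • b (k, 0) := by
  let I' : Module.End ℝ V := (-a⁻¹) • T
  have hI : I' * I' = -1 := by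
    ext x
    simp only [I', Module.End.mul_apply, LinearMap.smul_apply, map_smul, hT, LinearMap.neg_apply,
      Module.End.one_apply, smul_neg, smul_smul]
    congr 1
    rw [show -a⁻¹ * (-a⁻¹ * a ^ 2) = 1 by field_simp, one_smul]
  let φ : ℂ →ₐ[ℝ] Module.End ℝ V := Complex.lift ⟨I', hI⟩
  let _ : Module ℂ V := Module.compHom V φ.toRingHom
  have hsmul : ∀ (z : ℂ) (x : V), z • x = φ z x := fun _ _ => rfl
  have : IsScalarTower ℝ ℂ V := ⟨fun r z x => by simp [hsmul]⟩
  have : Module.Finite ℂ V := Module.Finite.of_restrictScalars_finite ℝ ℂ V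
  let B := Module.finBasis ℂ V
  refine ⟨Fin (Module.finrank ℂ V), inferInstance,
    (Complex.basisOneI.smulTower B).reindex (Equiv.prodComm _ _), fun k => ?_⟩
  have hI' : ∀ x : V, Complex.I • x = -(a⁻¹ • T x) := by
    intro x
    rw [hsmul]
    have : φ Complex.I = I' := Complex.liftAux_apply_I I' hI
    rw [this]
    simp [I']
  have hTI : ∀ x : V, T x = -(a • (Complex.I • x)) := by
    intro x
    rw [hI', smul_neg, neg_neg, smul_smul, mul_inv_cancel₀ ha, one_smul]
  have h0 : ((Complex.basisOneI.smulTower B).reindex (Equiv.prodComm _ _)) (k, 0) = B k := by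
    simp [Module.Basis.smulTower_apply]
  have h1 : ((Complex.basisOneI.smulTower B).reindex (Equiv.prodComm _ _)) (k, 1)
      = Complex.I • B k := by
    simp [Module.Basis.smulTower_apply]
  rw [h0, h1]
  refine ⟨hTI _, ?_⟩
  rw [hTI, smul_smul, Complex.I_mul_I, neg_smul, one_smul, smul_neg, neg_neg]

open Polynomial in
theorem LinearMap.coe_aeval_restrict_apply {V : Type*} [AddCommGroup V] [Module ℝ V]
    {T : V →ₗ[ℝ] V} {W : Submodule ℝ V} (h : ∀ x ∈ W, T x ∈ W) (r : ℝ[X]) (x : W) :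
    (aeval (R := ℝ) (A := Module.End ℝ W) (T.restrict h) r x : V)
      = aeval (R := ℝ) (A := Module.End ℝ V) T r x := by
  have hpow : ∀ k, ((((T.restrict h : Module.End ℝ W) ^ k) x : W) : V)
      = ((T : Module.End ℝ V) ^ k) x := by
    intro k
    induction k with
    | zero => simp
    | succ k ih =>
      rw [pow_succ', pow_succ', Module.End.mul_apply, Module.End.mul_apply, ← ih]
      rfl
  induction r using Polynomial.induction_on' with
  | add p q hp hq => simp [hp, hq]
  | monomial k c => simp [aeval_monomial, Algebra.algebraMap_eq_smul_one, hpow]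

open Polynomial in
theorem Matrix.aeval_toLin' {K : Type*} [Field K] {ι : Type*} [Fintype ι] [DecidableEq ι]
    (A : Matrix ι ι K) (p : K[X]) :
    aeval (R := K) (A := Module.End K (ι → K)) (Matrix.toLin' A) p
      = Matrix.toLin' (aeval A p) :=
  aeval_algHom_apply (Matrix.toLinAlgEquiv' (R := K) (n := ι)).toAlgHom A p

open Polynomial in
/-- Induction over the frequencies: the kernels of the coprime factors `X² + a²` and `modesPoly s`
of the annihilating polynomial are complementary invariant subspaces. -/
theorem exists_modes_basis (s : Finset ℝ) (hs : ∀ a ∈ s, 0 < a) :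
    ∀ (V : Type) [AddCommGroup V] [Module ℝ V] [FiniteDimensional ℝ V] (T : V →ₗ[ℝ] V),
      aeval T (modesPoly s) = 0 →
      ∃ (ι κ : Type) (_ : Fintype ι) (_ : Fintype κ) (ω : κ → ℝ)
        (b : Module.Basis (ι ⊕ κ × Fin 2) ℝ V), (∀ k, 0 < ω k) ∧
        (∀ i, T (b (Sum.inl i)) = 0) ∧
        ∀ k, T (b (Sum.inr (k, 0))) = -(ω k • b (Sum.inr (k, 1))) ∧
          T (b (Sum.inr (k, 1))) = ω k • b (Sum.inr (k, 0)) := by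
  induction s using Finset.induction_on with
  | empty =>
    intro V _ _ _ T hT
    have hT0 : T = 0 := by simpa [modesPoly] using hT
    refine ⟨Fin (Module.finrank ℝ V), Fin 0, inferInstance, inferInstance, fun _ => 1,
      (Module.finBasis ℝ V).reindex (Equiv.sumEmpty _ _).symm, fun _ => one_pos,
      fun i => by simp [hT0], fun k => k.elim0⟩
  | insert a s ha ih =>
    intro V _ _ _ T hT
    have ha0 : 0 < a := hs a (Finset.mem_insert_self _ _)
    have hs' : ∀ b ∈ s, 0 < b := fun b hb => hs b (Finset.mem_insert_of_mem hb)
    set q : ℝ[X] := X ^ 2 + C (a ^ 2) with hq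
    have hfac : modesPoly (insert a s) = q * modesPoly s := by
      rw [modesPoly, modesPoly, Finset.prod_insert ha]; ring
    have hcop : IsCoprime q (modesPoly s) := by
      have hunit : ∀ c : ℝ, c ≠ 0 → ∀ u v : ℝ[X], u - v = C c → IsCoprime u v := by
        intro c hc u v huv
        refine ⟨C c⁻¹, -C c⁻¹, ?_⟩
        rw [neg_mul, ← sub_eq_add_neg, ← mul_sub, huv, ← C_mul, inv_mul_cancel₀ hc, C_1]
      refine IsCoprime.mul_right ?_ (IsCoprime.prod_right fun b hb => ?_)
      · have : IsCoprime q (X ^ 2) := hunit (a ^ 2) (by positivity) _ _ (by rw [hq]; ring)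
        rwa [IsCoprime.pow_right_iff two_pos] at this
      · refine hunit (a ^ 2 - b ^ 2) ?_ _ _ (by rw [hq, C_sub]; ring)
        intro h
        have hb0 := hs' b hb
        have : a = b := by nlinarith
        exact ha (this ▸ hb)
    have hcompl : IsCompl (LinearMap.ker (aeval T q)) (LinearMap.ker (aeval T (modesPoly s))) := by
      refine ⟨disjoint_ker_aeval_of_isCoprime T hcop, codisjoint_iff.2 ?_⟩
      rw [sup_ker_aeval_eq_ker_aeval_mul_of_coprime T hcop, ← hfac, hT, LinearMap.ker_zero]
    have hinv : ∀ r : ℝ[X], ∀ x ∈ LinearMap.ker (aeval T r), T x ∈ LinearMap.ker (aeval T r) := by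
      intro r x hx
      rw [LinearMap.mem_ker] at hx ⊢
      have hc : aeval T X * aeval T r = aeval T r * aeval T X :=
        ((Commute.all X r).map (aeval T)).eq
      rw [aeval_X] at hc
      have := congrArg (fun f : Module.End ℝ V => f x) hc
      simpa [hx] using this.symm
    let T₁ := T.restrict (hinv q)
    let T₂ := T.restrict (hinv (modesPoly s))
    have hT₁ : ∀ x, T₁ (T₁ x) = -(a ^ 2 • x) := by
      rintro ⟨x, hx⟩
      ext
      have hx' : T (T x) + a ^ 2 • x = 0 := by
        simpa [hq, sq, Algebra.algebraMap_eq_smul_one, mul_smul] using hx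
      simpa [T₁] using eq_neg_of_add_eq_zero_left hx'
    have hT₂ : aeval T₂ (modesPoly s) = 0 := by
      ext ⟨x, hx⟩
      rw [LinearMap.coe_aeval_restrict_apply]
      exact hx
    obtain ⟨κ₁, _, b₁, hb₁⟩ := exists_basis_of_sq_eq_neg T₁ ha0.ne' hT₁
    obtain ⟨ι, κ₂, _, _, ω₂, b₂, hω₂, hb₂, hb₂'⟩ := ih hs' _ T₂ hT₂
    let e : (κ₁ × Fin 2) ⊕ (ι ⊕ κ₂ × Fin 2) ≃ ι ⊕ (κ₁ ⊕ κ₂) × Fin 2 :=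
      (Equiv.sumAssoc _ _ _).symm.trans <| ((Equiv.sumComm _ _).sumCongr (Equiv.refl _)).trans <|
        (Equiv.sumAssoc _ _ _).trans <|
          (Equiv.refl _).sumCongr (Equiv.sumProdDistrib _ _ _).symm
    let b := ((b₁.prod b₂).map (Submodule.prodEquivOfIsCompl _ _ hcompl)).reindex e
    have h1 : ∀ k c, b (Sum.inr (Sum.inl k, c)) = (b₁ (k, c) : V) := by
      intro k c; simp [b, e]
    have h2 : ∀ k c, b (Sum.inr (Sum.inr k, c)) = (b₂ (Sum.inr (k, c)) : V) := by
      intro k c; simp [b, e]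
    have h3 : ∀ i, b (Sum.inl i) = (b₂ (Sum.inl i) : V) := by
      intro k; simp [b, e]
    refine ⟨ι, κ₁ ⊕ κ₂, inferInstance, inferInstance, Sum.elim (fun _ => a) ω₂, b, ?_, ?_, ?_⟩
    · rintro (k | k)
      · exact ha0
      · exact hω₂ k
    · intro i
      rw [h3]
      exact congrArg Subtype.val (hb₂ i)
    · rintro (k | k)
      · rw [h1, h1]
        exact ⟨congrArg Subtype.val (hb₁ k).1, congrArg Subtype.val (hb₁ k).2⟩
      · rw [h2, h2]
        exact ⟨congrArg Subtype.val (hb₂' k).1, congrArg Subtype.val (hb₂' k).2⟩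

open Polynomial in
/-- The frequencies are the positive numbers `|im μ|` for the complex eigenvalues `μ`. The polynomial
vanishes at all eigenvalues, hence annihilates the eigenspaces, which span by semisimplicity. -/
theorem NeutrallyStable.exists_aeval_modesPoly_eq_zero {m : ℕ} {S : Matrix (Fin m) (Fin m) ℝ}
    (hS : NeutrallyStable S) :
    ∃ s : Finset ℝ, (∀ a ∈ s, 0 < a) ∧ aeval (Matrix.toLin' S) (modesPoly s) = 0 := by
  classical
  set T := Matrix.toLin' (S.map Complex.ofReal) with hT
  have hfin : {μ : ℂ | Module.End.HasEigenvalue T μ}.Finite := Module.End.finite_hasEigenvalue T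
  refine ⟨(hfin.toFinset.image fun μ => |μ.im|).filter fun a => 0 < a, fun a ha =>
    (Finset.mem_filter.1 ha).2, ?_⟩
  set s := (hfin.toFinset.image fun μ => |μ.im|).filter fun a => 0 < a with hs
  set p : ℂ[X] := (modesPoly s).map (algebraMap ℝ ℂ) with hp
  have hroot : ∀ μ, Module.End.HasEigenvalue T μ → p.eval μ = 0 := by
    intro μ hμ
    have hre := (hS μ hμ).1
    rw [hp, modesPoly, Polynomial.map_mul, Polynomial.map_X, eval_mul, eval_X,
      Polynomial.map_prod, eval_prod]
    by_cases him : μ.im = 0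
    · rw [show μ = 0 from Complex.ext hre him, zero_mul]
    · refine mul_eq_zero_of_right _ (Finset.prod_eq_zero (i := |μ.im|) ?_ ?_)
      · rw [hs, Finset.mem_filter]
        exact ⟨Finset.mem_image.2 ⟨μ, by simpa using hμ, rfl⟩, abs_pos.2 him⟩
      · have : μ = μ.im * Complex.I := Complex.ext (by simp [hre]) (by simp)
        simp only [Polynomial.map_add, Polynomial.map_pow, Polynomial.map_X, Polynomial.map_C,
          eval_add, eval_pow, eval_X, eval_C, sq_abs]
        conv_lhs => rw [this]
        simp [mul_pow]
  clear_value p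
  have hC : aeval T p = 0 := by
    rw [← LinearMap.ker_eq_top, eq_top_iff, ← Module.End.iSup_maxGenEigenspace_eq_top T]
    refine iSup_le fun μ x hx => ?_
    by_cases hμ : Module.End.HasEigenvalue T μ
    · rw [(hS μ hμ).2, Module.End.mem_eigenspace_iff] at hx
      rw [LinearMap.mem_ker, Module.End.aeval_apply_of_mem_apply_eq_smul hx, hroot μ hμ,
        zero_smul]
    · have : Module.End.maxGenEigenspace T μ = ⊥ := by
        by_contra h
        exact hμ (Module.End.HasUnifEigenvalue.lt (k := ⊤) (m := 1) zero_lt_one h)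
      have hx0 : x = 0 := by simpa [this] using hx
      rw [LinearMap.mem_ker, hx0, map_zero]
  have hM : aeval (S.map Complex.ofReal) p = 0 := by
    rw [hT, Matrix.aeval_toLin'] at hC
    exact (map_eq_zero_iff _ Matrix.toLin'.injective).1 hC
  have hMR : aeval S (modesPoly s) = 0 := by
    rw [hp] at hM
    have h := map_aeval_eq_aeval_map (φ := algebraMap ℝ ℂ)
      (ψ := Complex.ofRealHom.mapMatrix (m := Fin m)) (by
        ext x i j
        by_cases hij : i = j <;> simp [Matrix.algebraMap_matrix_apply, hij]) (modesPoly s) S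
    have h' : Complex.ofRealHom.mapMatrix (m := Fin m) (aeval S (modesPoly s)) = 0 :=
      h.trans hM
    ext i j
    simpa using congrFun (congrFun h' i) j
  rw [Matrix.aeval_toLin', hMR, map_zero]

theorem NeutrallyStable.exists_isNormalForm {m : ℕ} {S : Matrix (Fin m) (Fin m) ℝ}
    (hS : NeutrallyStable S) :
    ∃ (m₀ l : ℕ) (ω : Fin l → ℝ) (P : Matrix (LeaderIdx m₀ l) (Fin m) ℝ)
      (R : Matrix (Fin m) (LeaderIdx m₀ l) ℝ), (∀ k, 0 < ω k) ∧ IsNormalForm S ω P R := by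
  obtain ⟨s, hs, hp⟩ := hS.exists_aeval_modesPoly_eq_zero
  obtain ⟨ι, κ, _, _, ω, b, hω, hb, hb'⟩ := exists_modes_basis s hs _ _ hp
  let e₁ := Fintype.equivFin ι
  let e₂ := Fintype.equivFin κ
  let B : Module.Basis (LeaderIdx (Fintype.card ι) (Fintype.card κ)) ℝ (Fin m → ℝ) :=
    b.reindex (e₁.sumCongr (e₂.prodCongr (Equiv.refl _)))
  refine ⟨_, _, fun k => ω (e₂.symm k), B.toMatrix (Pi.basisFun ℝ (Fin m)),
    (Pi.basisFun ℝ (Fin m)).toMatrix B, fun k => hω _, ?_, ?_, ?_⟩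
  · exact Module.Basis.toMatrix_mul_toMatrix_flip _ _
  · exact Module.Basis.toMatrix_mul_toMatrix_flip _ _
  · have : B.toMatrix (Pi.basisFun ℝ (Fin m)) * S * (Pi.basisFun ℝ (Fin m)).toMatrix B
        = LinearMap.toMatrix B B (Matrix.toLin' S) := by
      rw [← basis_toMatrix_mul_linearMap_toMatrix_mul_basis_toMatrix
        B (Pi.basisFun ℝ (Fin m)) B (Pi.basisFun ℝ (Fin m)) (Matrix.toLin' S)]
      rw [LinearMap.toMatrix_eq_toMatrix', LinearMap.toMatrix'_toLin']
    rw [this]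
    ext i j
    rw [LinearMap.toMatrix_apply]
    have hL0 : ∀ i, B (Sum.inl i) = b (Sum.inl (e₁.symm i)) := fun i => by simp [B]
    have hL1 : ∀ k c, B (Sum.inr (k, c)) = b (Sum.inr (e₂.symm k, c)) := fun i c => by simp [B]
    rcases j with j | ⟨k, c⟩
    · rw [hL0, hb]
      rcases i with i | i <;> simp [leaderMatrix]
    · fin_cases c
      · have := (hb' (e₂.symm k)).1
        rw [← hL1, ← hL1] at this
        simp only [Fin.zero_eta]
        rw [this]
        rcases i with i | ⟨k', c'⟩
        · simp [leaderMatrix]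
        · by_cases hk : k = k'
          · subst hk
            fin_cases c' <;> simp [leaderMatrix]
          · fin_cases c' <;> simp [leaderMatrix, Ne.symm hk]
      · have := (hb' (e₂.symm k)).2
        rw [← hL1, ← hL1] at this
        simp only [Fin.mk_one]
        rw [this]
        rcases i with i | ⟨k', c'⟩
        · simp [leaderMatrix]
        · by_cases hk : k = k'
          · subst hk
            fin_cases c' <;> simp [leaderMatrix]
          · fin_cases c' <;> simp [leaderMatrix, Ne.symm hk]

/-! ### The neighbour error and the Dirichlet form of the communication graph -/

section Graph

variable {N m₀ l : ℕ} (G : Digraph (Fin (N + 1)))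

open Classical in
/-- The entry of the adjacency matrix for the edge `(j, i.succ)`: `1` if follower `i` receives
information from agent `j`, and `0` otherwise. -/
noncomputable def edgeWeight (j : Fin (N + 1)) (i : Fin N) : ℝ := if G.Adj j i.succ then 1 else 0

theorem edgeWeight_nonneg (j : Fin (N + 1)) (i : Fin N) : 0 ≤ edgeWeight G j i := by
  rw [edgeWeight]; split_ifs <;> norm_num

theorem FollowersUndirected.edgeWeight_symm {G : Digraph (Fin (N + 1))}
    (hU : FollowersUndirected G) (i j : Fin N) :
    edgeWeight G i.succ j = edgeWeight G j.succ i := by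
  have h : G.Adj i.succ j.succ ↔ G.Adj j.succ i.succ := ⟨hU i j, hU j i⟩
  by_cases hij : G.Adj i.succ j.succ
  · simp [edgeWeight, hij, h.1 hij]
  · simp [edgeWeight, hij, mt h.2 hij]

theorem neighborError_eq (w : LeaderIdx m₀ l → ℝ) (η : Fin N → LeaderIdx m₀ l → ℝ) (i : Fin N) :
    neighborError G w η i = edgeWeight G 0 i • (w - η i)
      + ∑ j : Fin N, edgeWeight G j.succ i • (η j - η i) := by
  rw [neighborError, Finset.sum_filter, Fin.sum_univ_succ]
  simp [edgeWeight, ite_smul]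

theorem neighborError_eq_sub_leader (w : LeaderIdx m₀ l → ℝ) (η : Fin N → LeaderIdx m₀ l → ℝ)
    (i : Fin N) : neighborError G w η i = neighborError G 0 (fun j => η j - w) i := by
  rw [neighborError_eq, neighborError_eq]
  simp

theorem mulVec_neighborError (A : Matrix (LeaderIdx m₀ l) (LeaderIdx m₀ l) ℝ)
    (w : LeaderIdx m₀ l → ℝ) (η : Fin N → LeaderIdx m₀ l → ℝ) (i : Fin N) :
    A *ᵥ neighborError G w η i = neighborError G (A *ᵥ w) (fun j => A *ᵥ η j) i := by
  rw [neighborError_eq, neighborError_eq, Matrix.mulVec_add, Matrix.mulVec_smul,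
    Matrix.mulVec_sub, Matrix.mulVec_sum]
  simp only [Matrix.mulVec_smul, Matrix.mulVec_sub]

theorem HasDerivWithinAt.neighborError {J : Set ℝ} {t : ℝ} {w : ℝ → LeaderIdx m₀ l → ℝ}
    {w' : LeaderIdx m₀ l → ℝ} (hw : HasDerivWithinAt w w' J t)
    {η : ℝ → Fin N → LeaderIdx m₀ l → ℝ} {η' : Fin N → LeaderIdx m₀ l → ℝ}
    (hη : ∀ i, HasDerivWithinAt (fun s => η s i) (η' i) J t) (i : Fin N) :
    HasDerivWithinAt (fun s => _root_.neighborError G (w s) (η s) i)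
      (_root_.neighborError G w' η' i) J t := by
  simp only [neighborError_eq]
  exact ((hw.sub (hη i)).const_smul (edgeWeight G 0 i)).add
    (HasDerivWithinAt.fun_sum fun j _ =>
      ((hη j).sub (hη i)).const_smul (edgeWeight G j.succ i))

theorem LocallyLipschitz.neighborError {X : Type*} [PseudoEMetricSpace X]
    {w : X → LeaderIdx m₀ l → ℝ} (hw : LocallyLipschitz w) {η : X → Fin N → LeaderIdx m₀ l → ℝ}
    (hη : ∀ i, LocallyLipschitz fun x => η x i) (i : Fin N) :
    LocallyLipschitz fun x => _root_.neighborError G (w x) (η x) i := by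
  simp only [neighborError_eq]
  exact ((LocallyLipschitz.const _).smul_real (hw.sub (hη i))).add
    (.finset_sum _ fun j => (LocallyLipschitz.const _).smul_real ((hη j).sub (hη i)))

/-- Summation by parts: `ξ ↦ -neighborError G 0 ξ` is the grounded graph Laplacian, and its
bilinear form is the Dirichlet form of the graph. -/
theorem FollowersUndirected.sum_dotProduct_neighborError {G : Digraph (Fin (N + 1))}
    (hU : FollowersUndirected G) (ζ ξ : Fin N → LeaderIdx m₀ l → ℝ) :
    ∑ i, ζ i ⬝ᵥ neighborError G 0 ξ i
      = -(∑ i, edgeWeight G 0 i * (ζ i ⬝ᵥ ξ i) + 1 / 2 *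
          ∑ i, ∑ j : Fin N, edgeWeight G j.succ i * ((ζ i - ζ j) ⬝ᵥ (ξ i - ξ j))) := by
  have h1 : ∑ i, ζ i ⬝ᵥ neighborError G 0 ξ i = -(∑ i, edgeWeight G 0 i * (ζ i ⬝ᵥ ξ i))
      - ∑ i, ∑ j : Fin N, edgeWeight G j.succ i * (ζ i ⬝ᵥ (ξ i - ξ j)) := by
    rw [← Finset.sum_neg_distrib, ← Finset.sum_sub_distrib]
    refine Finset.sum_congr rfl fun i _ => ?_
    rw [neighborError_eq, dotProduct_add, dotProduct_sum, dotProduct_smul, zero_sub,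
      dotProduct_neg, smul_eq_mul, mul_neg, sub_eq_add_neg, ← Finset.sum_neg_distrib]
    congr 1
    refine Finset.sum_congr rfl fun j _ => ?_
    rw [dotProduct_smul, smul_eq_mul, ← neg_sub, dotProduct_neg, mul_neg]
  have h2 : ∑ i, ∑ j : Fin N, edgeWeight G j.succ i * (ζ j ⬝ᵥ (ξ i - ξ j))
      = -∑ i, ∑ j : Fin N, edgeWeight G j.succ i * (ζ i ⬝ᵥ (ξ i - ξ j)) := by
    rw [Finset.sum_comm, ← Finset.sum_neg_distrib]
    refine Finset.sum_congr rfl fun i _ => ?_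
    rw [← Finset.sum_neg_distrib]
    refine Finset.sum_congr rfl fun j _ => ?_
    rw [hU.edgeWeight_symm, ← neg_sub, dotProduct_neg, mul_neg]
  have h3 : ∑ i, ∑ j : Fin N, edgeWeight G j.succ i * ((ζ i - ζ j) ⬝ᵥ (ξ i - ξ j))
      = ∑ i, ∑ j : Fin N, edgeWeight G j.succ i * (ζ i ⬝ᵥ (ξ i - ξ j))
        - ∑ i, ∑ j : Fin N, edgeWeight G j.succ i * (ζ j ⬝ᵥ (ξ i - ξ j)) := by
    simp only [sub_dotProduct _ _ (_ - _), mul_sub, Finset.sum_sub_distrib]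
  rw [h1, h3, h2]
  ring

theorem FollowersUndirected.sum_dotProduct_neighborError_comm {G : Digraph (Fin (N + 1))}
    (hU : FollowersUndirected G) (ζ ξ : Fin N → LeaderIdx m₀ l → ℝ) :
    ∑ i, ζ i ⬝ᵥ neighborError G 0 ξ i = ∑ i, ξ i ⬝ᵥ neighborError G 0 ζ i := by
  rw [hU.sum_dotProduct_neighborError, hU.sum_dotProduct_neighborError]
  simp only [dotProduct_comm]

theorem continuous_sum_dotProduct_neighborError :
    Continuous fun ξ : Fin N → LeaderIdx m₀ l → ℝ => ∑ i, ξ i ⬝ᵥ neighborError G 0 ξ i := by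
  refine continuous_finsetSum _ fun i _ => Continuous.dotProduct (continuous_apply i) ?_
  simp only [neighborError_eq]
  fun_prop

/-- The Dirichlet form is positive definite: if it vanishes at `ξ`, then `ξ` is constant along
edges, and it is zero at the leader, from which every follower can be reached. -/
theorem HasLeaderSpanningTree.exists_pos_mul_norm_sq_le {G : Digraph (Fin (N + 1))}
    (hG : HasLeaderSpanningTree G) (hU : FollowersUndirected G) :
    ∃ c : ℝ, 0 < c ∧ ∀ ξ : Fin N → LeaderIdx m₀ l → ℝ,
      c * ‖ξ‖ ^ 2 ≤ -∑ i, ξ i ⬝ᵥ neighborError G 0 ξ i := by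
  refine _root_.exists_pos_mul_norm_sq_le
    (Q := fun ξ : Fin N → LeaderIdx m₀ l → ℝ => -∑ i, ξ i ⬝ᵥ neighborError G 0 ξ i)
    (continuous_sum_dotProduct_neighborError G).neg (fun c ξ => ?_) fun ξ hξ => ?_
  · rw [hU.sum_dotProduct_neighborError, hU.sum_dotProduct_neighborError]
    simp only [Pi.smul_apply, ← smul_sub, smul_dotProduct, dotProduct_smul, smul_eq_mul,
      Finset.mul_sum, mul_add, neg_neg]
    congr 1
    · exact Finset.sum_congr rfl fun i _ => by ring
    · exact Finset.sum_congr rfl fun i _ => Finset.sum_congr rfl fun j _ => by ring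
  · rw [hU.sum_dotProduct_neighborError, neg_neg]
    have hsq : ∀ x : LeaderIdx m₀ l → ℝ, 0 ≤ x ⬝ᵥ x := fun x =>
      (sq_nonneg _).trans (norm_sq_le_dotProduct_self x)
    have hA : ∀ i ∈ Finset.univ, 0 ≤ edgeWeight G 0 i * (ξ i ⬝ᵥ ξ i) := fun i _ =>
      mul_nonneg (edgeWeight_nonneg _ _ _) (hsq _)
    have hB : ∀ i j : Fin N, 0 ≤ edgeWeight G j.succ i * ((ξ i - ξ j) ⬝ᵥ (ξ i - ξ j)) :=
      fun i j => mul_nonneg (edgeWeight_nonneg _ _ _) (hsq _)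
    have hB' : ∀ i ∈ Finset.univ, 0 ≤ ∑ j : Fin N,
        edgeWeight G j.succ i * ((ξ i - ξ j) ⬝ᵥ (ξ i - ξ j)) := fun i _ =>
      Finset.sum_nonneg fun j _ => hB i j
    refine lt_of_le_of_ne (add_nonneg (Finset.sum_nonneg hA)
      (mul_nonneg (by norm_num) (Finset.sum_nonneg hB'))) fun h0 => hξ ?_
    have hAs := Finset.sum_nonneg hA
    have hBs := Finset.sum_nonneg hB'
    have hA0 := (Finset.sum_eq_zero_iff_of_nonneg hA).1 (by linarith)
    have hB0 := (Finset.sum_eq_zero_iff_of_nonneg hB').1 (by linarith)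
    have hzero : ∀ k : Fin (N + 1),
        (Fin.cons 0 ξ : Fin (N + 1) → LeaderIdx m₀ l → ℝ) k = 0 := by
      intro k
      induction hG k with
      | refl => rfl
      | @tail j k _ hjk ih =>
        cases k using Fin.cases with
        | zero => rfl
        | succ k =>
          rw [Fin.cons_succ]
          cases j using Fin.cases with
          | zero =>
            have := hA0 k (Finset.mem_univ _)
            rw [edgeWeight, if_pos hjk, one_mul] at this
            exact dotProduct_self_eq_zero.1 this
          | succ j =>
            have := (Finset.sum_eq_zero_iff_of_nonneg fun j _ => hB k j).1
              (hB0 k (Finset.mem_univ _)) j (Finset.mem_univ _)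
            rw [edgeWeight, if_pos hjk, one_mul] at this
            rw [sub_eq_zero.1 (dotProduct_self_eq_zero.1 this)]
            rwa [Fin.cons_succ] at ih
    funext i
    simpa using hzero i.succ

end Graph

/-! ### The leader matrix -/

section LeaderMatrix

variable {m₀ l : ℕ}

theorem leaderMatrix_sub (ω ω' : Fin l → ℝ) :
    leaderMatrix m₀ (ω - ω') = leaderMatrix m₀ ω - leaderMatrix m₀ ω' := by
  ext (i | ⟨k, c⟩) (j | ⟨k', c'⟩)
  · simp [leaderMatrix]
  · simp [leaderMatrix]
  · simp [leaderMatrix]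
  · by_cases hk : k = k'
    · subst hk
      simp [leaderMatrix, sub_mul]
    · simp [leaderMatrix, hk]

theorem leaderMatrix_mulVec_inl (ω : Fin l → ℝ) (x : LeaderIdx m₀ l → ℝ) (i : Fin m₀) :
    (leaderMatrix m₀ ω *ᵥ x) (Sum.inl i) = 0 := by
  simp [leaderMatrix, Matrix.mulVec, dotProduct]

theorem leaderMatrix_mulVec_inr (ω : Fin l → ℝ) (x : LeaderIdx m₀ l → ℝ) (k : Fin l) :
    (leaderMatrix m₀ ω *ᵥ x) (Sum.inr (k, 0)) = ω k * x (Sum.inr (k, 1)) ∧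
    (leaderMatrix m₀ ω *ᵥ x) (Sum.inr (k, 1)) = -(ω k * x (Sum.inr (k, 0))) := by
  constructor <;>
  · simp [leaderMatrix, Matrix.mulVec, dotProduct, Fintype.sum_prod_type, Matrix.diagonal_apply]

theorem phi_mulVec (x y : LeaderIdx m₀ l → ℝ) (k : Fin l) :
    (phi x *ᵥ y) k = x (Sum.inr (k, 0)) * y (Sum.inr (k, 1))
      - x (Sum.inr (k, 1)) * y (Sum.inr (k, 0)) := by
  simp [phi, Matrix.mulVec, dotProduct, Fintype.sum_prod_type]
  ring

/-- The matrices `S(ω)` and `φ` are adjoint to each other. This is what makes the frequency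
adaptation cancel the frequency error in the Lyapunov function. -/
theorem dotProduct_leaderMatrix_mulVec (ω : Fin l → ℝ) (x y : LeaderIdx m₀ l → ℝ) :
    x ⬝ᵥ (leaderMatrix m₀ ω *ᵥ y) = ω ⬝ᵥ (phi x *ᵥ y) := by
  simp only [dotProduct, Fintype.sum_sum_type, leaderMatrix_mulVec_inl, Fintype.sum_prod_type,
    Fin.sum_univ_two, leaderMatrix_mulVec_inr, phi_mulVec, mul_zero, Finset.sum_const_zero,
    zero_add]
  exact Finset.sum_congr rfl fun k _ => by ring

theorem leaderMatrix_transpose (ω : Fin l → ℝ) : (leaderMatrix m₀ ω)ᵀ = -leaderMatrix m₀ ω := by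
  ext (i | ⟨k, c⟩) (j | ⟨k', c'⟩)
  · simp [leaderMatrix]
  · simp [leaderMatrix]
  · simp [leaderMatrix]
  · by_cases hk : k = k'
    · subst hk
      fin_cases c <;> fin_cases c' <;> simp [leaderMatrix]
    · simp [leaderMatrix, hk, Ne.symm hk]

theorem hasDerivWithinAt_leaderMatrix {J : Set ℝ} {t : ℝ} {ω : ℝ → Fin l → ℝ} {ω' : Fin l → ℝ}
    (h : HasDerivWithinAt ω ω' J t) (i j : LeaderIdx m₀ l) :
    HasDerivWithinAt (fun s => leaderMatrix m₀ (ω s) i j) (leaderMatrix m₀ ω' i j) J t := by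
  rw [hasDerivWithinAt_pi] at h
  rcases i with i | ⟨k, c⟩ <;> rcases j with j | ⟨k', c'⟩
  · simpa [leaderMatrix] using hasDerivWithinAt_const t J (0 : ℝ)
  · simpa [leaderMatrix] using hasDerivWithinAt_const t J (0 : ℝ)
  · simpa [leaderMatrix] using hasDerivWithinAt_const t J (0 : ℝ)
  · by_cases hk : k = k'
    · subst hk
      simpa [leaderMatrix] using (h k).mul_const (!![(0 : ℝ), 1; -1, 0] c c')
    · simpa [leaderMatrix, hk] using hasDerivWithinAt_const t J (0 : ℝ)

theorem locallyLipschitz_leaderMatrix {X : Type*} [PseudoEMetricSpace X] {ω : X → Fin l → ℝ}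
    (h : LocallyLipschitz ω) (i j : LeaderIdx m₀ l) :
    LocallyLipschitz fun x => leaderMatrix m₀ (ω x) i j := by
  rcases i with i | ⟨k, c⟩ <;> rcases j with j | ⟨k', c'⟩
  · simpa [leaderMatrix] using LocallyLipschitz.const (0 : ℝ)
  · simpa [leaderMatrix] using LocallyLipschitz.const (0 : ℝ)
  · simpa [leaderMatrix] using LocallyLipschitz.const (0 : ℝ)
  · by_cases hk : k = k'
    · subst hk
      simpa [leaderMatrix] using (h.apply k).mul_real (.const (!![(0 : ℝ), 1; -1, 0] c c'))
    · simpa [leaderMatrix, hk] using LocallyLipschitz.const (0 : ℝ)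

theorem LocallyLipschitz.phi_mulVec {X : Type*} [PseudoEMetricSpace X]
    {x y : X → LeaderIdx m₀ l → ℝ} (hx : LocallyLipschitz x) (hy : LocallyLipschitz y) :
    LocallyLipschitz fun z => phi (x z) *ᵥ y z := by
  refine .pi fun k => ?_
  simp only [_root_.phi_mulVec]
  exact ((hx.apply _).mul_real (hy.apply _)).sub ((hx.apply _).mul_real (hy.apply _))

end LeaderMatrix

/-! ### The closed loop as an autonomous differential equation -/

theorem EulerLagrangeSystem.isUnit_inertia {n : ℕ} (sys : EulerLagrangeSystem n) (q : Fin n → ℝ) :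
    IsUnit (sys.M q) := by
  obtain ⟨c, hc, h⟩ := sys.inertia_pos
  rw [← Matrix.mulVec_injective_iff_isUnit]
  refine (injective_iff_map_eq_zero (Matrix.mulVecLin (sys.M q))).2 fun x hx => ?_
  have h1 := h q x
  rw [Matrix.mulVecLin_apply] at hx
  rw [hx, dotProduct_zero] at h1
  have h2 := norm_sq_le_dotProduct_self x
  have h3 : ‖x‖ ^ 2 ≤ 0 := by nlinarith
  exact norm_eq_zero.1 (pow_eq_zero_iff two_ne_zero |>.1 (le_antisymm h3 (sq_nonneg _)))

section ClosedLoop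

variable {N n m p m₀ l : ℕ}

/-- The state of a follower as an element of a normed space. -/
abbrev FlatState (n p m₀ l : ℕ) : Type :=
  (Fin n → ℝ) × (Fin n → ℝ) × (Fin p → ℝ) × (LeaderIdx m₀ l → ℝ) × (Fin l → ℝ)

/-- The coordinates `(q, dq, Θhat, η, ω)` of a follower's state. -/
def AgentState.toFlat (a : AgentState n p m₀ l) : FlatState n p m₀ l :=
  (a.q, a.dq, a.Θhat, a.η, a.ω)

/-- The inverse of `AgentState.toFlat`. -/
def AgentState.ofFlat (a : FlatState n p m₀ l) : AgentState n p m₀ l :=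
  ⟨a.1, a.2.1, a.2.2.1, a.2.2.2.1, a.2.2.2.2⟩

/-- The right-hand side of the closed loop in the variables `(v, x)`, with the Euler–Lagrange
equations solved for the accelerations. -/
noncomputable def closedLoopField (G : Digraph (Fin (N + 1)))
    (S : Matrix (Fin m) (Fin m) ℝ) (C : Matrix (Fin n) (Fin m) ℝ)
    (P : Matrix (LeaderIdx m₀ l) (Fin m) ℝ) (R : Matrix (Fin m) (LeaderIdx m₀ l) ℝ)
    (sys : Fin N → EulerLagrangeSystem n) (Y : Fin N → RegressorFun n p) (g : Gains N n p)
    (z : (Fin m → ℝ) × (Fin N → FlatState n p m₀ l)) :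
    (Fin m → ℝ) × (Fin N → FlatState n p m₀ l) :=
  (S *ᵥ z.1, fun i =>
    let a := AgentState.ofFlat (z.2 i)
    let e := neighborError G (P *ᵥ z.1) (fun j => (AgentState.ofFlat (z.2 j)).η) i
    (a.dq, ((sys i).M a.q)⁻¹ *ᵥ (ControlLaw.torque g i (Y i) (C * R) a e
        - (sys i).C a.q a.dq *ᵥ a.dq - (sys i).G a.q),
      ControlLaw.thetaRate g i (Y i) (C * R) a e, ControlLaw.etaRate g.μ₁ a e,
      ControlLaw.omegaRate g.μ₂ a e))

section FieldRegularity

variable {X : Type*} [PseudoEMetricSpace X] {a : X → AgentState n p m₀ l}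
  {e : X → LeaderIdx m₀ l → ℝ}

theorem locallyLipschitz_etaRate (μ₁ : ℝ) (hη : LocallyLipschitz fun x => (a x).η)
    (hω : LocallyLipschitz fun x => (a x).ω) (he : LocallyLipschitz e) :
    LocallyLipschitz fun x => ControlLaw.etaRate μ₁ (a x) (e x) :=
  (LocallyLipschitz.mulVec (locallyLipschitz_leaderMatrix hω) hη).add
    ((LocallyLipschitz.const μ₁).smul_real he)

theorem locallyLipschitz_omegaRate (μ₂ : ℝ) (hη : LocallyLipschitz fun x => (a x).η)
    (he : LocallyLipschitz e) :
    LocallyLipschitz fun x => ControlLaw.omegaRate μ₂ (a x) (e x) :=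
  (LocallyLipschitz.const μ₂).smul_real (he.phi_mulVec hη)

theorem locallyLipschitz_refVel (C : Matrix (Fin n) (LeaderIdx m₀ l) ℝ) (α : ℝ)
    (hq : LocallyLipschitz fun x => (a x).q) (hη : LocallyLipschitz fun x => (a x).η)
    (hω : LocallyLipschitz fun x => (a x).ω) :
    LocallyLipschitz fun x => ControlLaw.refVel C α (a x) :=
  (LocallyLipschitz.const_mulVec C
    (LocallyLipschitz.mulVec (locallyLipschitz_leaderMatrix hω) hη)).sub
    ((LocallyLipschitz.const α).smul_real (hq.sub (hη.const_mulVec C)))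

variable (ha : LocallyLipschitz fun x => (a x).toFlat) (he : LocallyLipschitz e)
include ha

theorem locallyLipschitz_q : LocallyLipschitz fun x => (a x).q :=
  LipschitzWith.prod_fst.locallyLipschitz.comp ha

theorem locallyLipschitz_dq : LocallyLipschitz fun x => (a x).dq :=
  (LipschitzWith.prod_fst.comp LipschitzWith.prod_snd).locallyLipschitz.comp ha

theorem locallyLipschitz_Θhat : LocallyLipschitz fun x => (a x).Θhat :=
  (LipschitzWith.prod_fst.comp
    (LipschitzWith.prod_snd.comp LipschitzWith.prod_snd)).locallyLipschitz.comp ha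

theorem locallyLipschitz_η : LocallyLipschitz fun x => (a x).η :=
  (LipschitzWith.prod_fst.comp (LipschitzWith.prod_snd.comp
    (LipschitzWith.prod_snd.comp LipschitzWith.prod_snd))).locallyLipschitz.comp ha

theorem locallyLipschitz_ω : LocallyLipschitz fun x => (a x).ω :=
  (LipschitzWith.prod_snd.comp (LipschitzWith.prod_snd.comp
    (LipschitzWith.prod_snd.comp LipschitzWith.prod_snd))).locallyLipschitz.comp ha

theorem locallyLipschitz_slide (C : Matrix (Fin n) (LeaderIdx m₀ l) ℝ) (α : ℝ) :
    LocallyLipschitz fun x => ControlLaw.slide C α (a x) :=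
  (locallyLipschitz_dq ha).sub (locallyLipschitz_refVel C α (locallyLipschitz_q ha)
    (locallyLipschitz_η ha) (locallyLipschitz_ω ha))

include he

theorem locallyLipschitz_refAcc (C : Matrix (Fin n) (LeaderIdx m₀ l) ℝ) (α μ₁ μ₂ : ℝ) :
    LocallyLipschitz fun x => ControlLaw.refAcc C α μ₁ μ₂ (a x) (e x) := by
  have hη := locallyLipschitz_η ha
  have hω := locallyLipschitz_ω ha
  have h1 := locallyLipschitz_etaRate μ₁ hη hω he
  have h2 := locallyLipschitz_omegaRate μ₂ hη he
  exact (((LocallyLipschitz.mulVec (locallyLipschitz_leaderMatrix hω) h1).const_mulVec C).add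
    ((LocallyLipschitz.mulVec (locallyLipschitz_leaderMatrix h2) hη).const_mulVec C)).sub
    ((LocallyLipschitz.const α).smul_real ((locallyLipschitz_dq ha).sub (h1.const_mulVec C)))

theorem locallyLipschitz_regressor {sys : EulerLagrangeSystem n} {Y : RegressorFun n p}
    {Θ : Fin p → ℝ} (hY : IsRegressor sys Y Θ) (C : Matrix (Fin n) (LeaderIdx m₀ l) ℝ)
    (α μ₁ μ₂ : ℝ) (r : Fin n) (c : Fin p) :
    LocallyLipschitz fun x => ControlLaw.regressor Y C α μ₁ μ₂ (a x) (e x) r c :=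
  (hY.lipschitz r c).comp ((locallyLipschitz_q ha).prodMk ((locallyLipschitz_dq ha).prodMk
    ((locallyLipschitz_refAcc ha he C α μ₁ μ₂).prodMk (locallyLipschitz_refVel C α
      (locallyLipschitz_q ha) (locallyLipschitz_η ha) (locallyLipschitz_ω ha)))))

theorem locallyLipschitz_torque {sys : EulerLagrangeSystem n} {Y : RegressorFun n p}
    {Θ : Fin p → ℝ} (hY : IsRegressor sys Y Θ) (C : Matrix (Fin n) (LeaderIdx m₀ l) ℝ)
    (g : Gains N n p) (i : Fin N) :
    LocallyLipschitz fun x => ControlLaw.torque g i Y C (a x) (e x) :=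
  ((locallyLipschitz_slide ha C g.α).const_mulVec (g.K i)).neg_pi.add
    (.mulVec (locallyLipschitz_regressor ha he hY C _ _ _) (locallyLipschitz_Θhat ha))

theorem locallyLipschitz_thetaRate {sys : EulerLagrangeSystem n} {Y : RegressorFun n p}
    {Θ : Fin p → ℝ} (hY : IsRegressor sys Y Θ) (C : Matrix (Fin n) (LeaderIdx m₀ l) ℝ)
    (g : Gains N n p) (i : Fin N) :
    LocallyLipschitz fun x => ControlLaw.thetaRate g i Y C (a x) (e x) :=
  (LocallyLipschitz.const_mulVec _ (LocallyLipschitz.mulVec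
    (fun r c => locallyLipschitz_regressor ha he hY C _ _ _ c r)
    (locallyLipschitz_slide ha C g.α))).neg_pi

omit he in
theorem locallyLipschitz_acceleration (sys : EulerLagrangeSystem n) {u : X → Fin n → ℝ}
    (hu : LocallyLipschitz u) :
    LocallyLipschitz fun x => (sys.M (a x).q)⁻¹ *ᵥ
      (u x - sys.C (a x).q (a x).dq *ᵥ (a x).dq - sys.G (a x).q) := by
  have hq := locallyLipschitz_q ha
  have hdq := locallyLipschitz_dq ha
  refine .mulVec (fun i j => ?_) ((hu.sub (.mulVec (fun i j => ?_) hdq)).sub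
    (sys.gravity_lipschitz.comp hq))
  · exact (Matrix.contDiff_inv_apply sys.inertia_contDiff sys.isUnit_inertia i
      j).locallyLipschitz.comp hq
  · exact (sys.coriolis_lipschitz i j).comp (hq.prodMk hdq)

end FieldRegularity

variable {G : Digraph (Fin (N + 1))} {S : Matrix (Fin m) (Fin m) ℝ} {C : Matrix (Fin n) (Fin m) ℝ}
  {P : Matrix (LeaderIdx m₀ l) (Fin m) ℝ} {R : Matrix (Fin m) (LeaderIdx m₀ l) ℝ}
  {sys : Fin N → EulerLagrangeSystem n} {Y : Fin N → RegressorFun n p} {Θ : Fin N → Fin p → ℝ}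
  {g : Gains N n p}

theorem locallyLipschitz_snd_apply (i : Fin N) :
    LocallyLipschitz fun z : (Fin m → ℝ) × (Fin N → FlatState n p m₀ l) =>
      (AgentState.ofFlat (z.2 i)).toFlat :=
  ((LipschitzWith.eval i).comp LipschitzWith.prod_snd).locallyLipschitz

theorem locallyLipschitz_neighborError_snd (G : Digraph (Fin (N + 1)))
    (P : Matrix (LeaderIdx m₀ l) (Fin m) ℝ) (i : Fin N) :
    LocallyLipschitz fun z : (Fin m → ℝ) × (Fin N → FlatState n p m₀ l) =>
      neighborError G (P *ᵥ z.1) (fun j => (AgentState.ofFlat (z.2 j)).η) i :=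
  LocallyLipschitz.neighborError G
    (LipschitzWith.prod_fst.locallyLipschitz.const_mulVec P)
    (fun j => locallyLipschitz_η (locallyLipschitz_snd_apply j)) i

theorem locallyLipschitz_closedLoopField (hY : ∀ i, IsRegressor (sys i) (Y i) (Θ i)) :
    LocallyLipschitz (closedLoopField G S C P R sys Y g) := by
  refine (LipschitzWith.prod_fst.locallyLipschitz.const_mulVec S).prodMk
    (.pi fun i => ?_)
  have ha := locallyLipschitz_snd_apply (m := m) (n := n) (p := p) (m₀ := m₀) (l := l) i
  have he := locallyLipschitz_neighborError_snd (n := n) (p := p) G P i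
  exact (locallyLipschitz_dq ha).prodMk ((locallyLipschitz_acceleration ha (sys i)
    (locallyLipschitz_torque ha he (hY i) (C * R) g i)).prodMk
    ((locallyLipschitz_thetaRate ha he (hY i) (C * R) g i).prodMk
    ((locallyLipschitz_etaRate g.μ₁ (locallyLipschitz_η ha) (locallyLipschitz_ω ha) he).prodMk
      (locallyLipschitz_omegaRate g.μ₂ (locallyLipschitz_η ha) he))))

/-- The closed-loop state as a curve in a normed space. -/
def flatCurve (v : ℝ → Fin m → ℝ) (x : ℝ → Fin N → AgentState n p m₀ l) (t : ℝ) :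
    (Fin m → ℝ) × (Fin N → FlatState n p m₀ l) :=
  (v t, fun i => (x t i).toFlat)

theorem IsClosedLoopSolution.hasDerivWithinAt_flatCurve {J : Set ℝ} {v : ℝ → Fin m → ℝ}
    {x : ℝ → Fin N → AgentState n p m₀ l} (h : IsClosedLoopSolution G S C P R sys Y g J v x)
    {t : ℝ} (ht : t ∈ J) :
    HasDerivWithinAt (flatCurve v x) (closedLoopField G S C P R sys Y g (flatCurve v x t)) J t := by
  refine (h.leader t ht).prodMk (hasDerivWithinAt_pi.2 fun i => ?_)
  obtain ⟨acc, hacc, hdyn⟩ := h.dynamics i t ht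
  have hacc' : acc = ((sys i).M (x t i).q)⁻¹ *ᵥ (ControlLaw.torque g i (Y i) (C * R) (x t i)
      (neighborError G (P *ᵥ v t) (fun j => (x t j).η) i)
        - (sys i).C (x t i).q (x t i).dq *ᵥ (x t i).dq - (sys i).G (x t i).q) := by
    rw [← hdyn, add_sub_right_comm, add_sub_cancel_right, add_sub_cancel_right,
      Matrix.mulVec_mulVec, Matrix.nonsing_inv_mul _
        ((Matrix.isUnit_iff_isUnit_det _).1 ((sys i).isUnit_inertia _)), Matrix.one_mulVec]
  rw [hacc'] at hacc
  exact (h.position i t ht).prodMk (hacc.prodMk ((h.theta i t ht).prodMk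
    ((h.eta i t ht).prodMk (h.omega i t ht))))

theorem isClosedLoopSolution_of_hasDerivWithinAt {J : Set ℝ} {v : ℝ → Fin m → ℝ}
    {x : ℝ → Fin N → AgentState n p m₀ l}
    (h : ∀ t ∈ J, HasDerivWithinAt (flatCurve v x)
      (closedLoopField G S C P R sys Y g (flatCurve v x t)) J t) :
    IsClosedLoopSolution G S C P R sys Y g J v x := by
  have h2 := fun t ht => hasDerivWithinAt_pi.1 (h t ht).snd
  have hs := fun i t ht => (h2 t ht i).snd
  refine ⟨fun t ht => (h t ht).fst, fun i t ht => (h2 t ht i).fst, fun i t ht =>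
    ⟨_, (hs i t ht).fst, ?_⟩, fun i t ht => (hs i t ht).snd.fst,
    fun i t ht => (hs i t ht).snd.snd.fst, fun i t ht => (hs i t ht).snd.snd.snd⟩
  change (sys i).M (x t i).q *ᵥ (((sys i).M (x t i).q)⁻¹ *ᵥ
    (ControlLaw.torque g i (Y i) (C * R) (x t i)
      (neighborError G (P *ᵥ v t) (fun j => (x t j).η) i)
        - (sys i).C (x t i).q (x t i).dq *ᵥ (x t i).dq - (sys i).G (x t i).q)) + _ + _ = _
  rw [Matrix.mulVec_mulVec, Matrix.mul_nonsing_inv _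
    ((Matrix.isUnit_iff_isUnit_det _).1 ((sys i).isUnit_inertia _)), Matrix.one_mulVec]
  abel

end ClosedLoop

/-! ### Lyapunov functions of the closed loop -/

theorem antitoneOn_of_hasDerivWithinAt_of_nonpos {J : Set ℝ} (hJ : Convex ℝ J) {F F' : ℝ → ℝ}
    (hF : ∀ t ∈ J, HasDerivWithinAt F (F' t) J t) (hF' : ∀ t ∈ J, F' t ≤ 0) : AntitoneOn F J :=
  antitoneOn_of_hasDerivWithinAt_nonpos hJ (fun t ht => (hF t ht).continuousWithinAt)
    (fun t ht => (hF t (interior_subset ht)).mono interior_subset)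
    (fun t ht => hF' t (interior_subset ht))

theorem norm_le_sqrt_of_mul_sq_le {E : Type*} [SeminormedAddGroup E] {x : E} {c V : ℝ}
    (hc : 0 < c) (h : c * ‖x‖ ^ 2 ≤ V) : ‖x‖ ≤ √(V / c) :=
  Real.le_sqrt_of_sq_le (by rw [le_div_iff₀ hc]; linarith)

theorem IsNormalForm.mul_mulVec {m m₀ l : ℕ} {S : Matrix (Fin m) (Fin m) ℝ} {ω : Fin l → ℝ}
    {P : Matrix (LeaderIdx m₀ l) (Fin m) ℝ} {R : Matrix (Fin m) (LeaderIdx m₀ l) ℝ}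
    (h : IsNormalForm S ω P R) (v : Fin m → ℝ) :
    P *ᵥ (S *ᵥ v) = leaderMatrix m₀ ω *ᵥ (P *ᵥ v) := by
  rw [← h.conj, Matrix.mulVec_mulVec, Matrix.mulVec_mulVec, Matrix.mul_assoc, h.left_inv,
    Matrix.mul_one]

theorem IsNormalForm.mulVec_mulVec_self {m m₀ l : ℕ} {S : Matrix (Fin m) (Fin m) ℝ}
    {ω : Fin l → ℝ} {P : Matrix (LeaderIdx m₀ l) (Fin m) ℝ}
    {R : Matrix (Fin m) (LeaderIdx m₀ l) ℝ} (h : IsNormalForm S ω P R) (v : Fin m → ℝ) :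
    R *ᵥ (P *ᵥ v) = v := by
  rw [Matrix.mulVec_mulVec, h.left_inv, Matrix.one_mulVec]

namespace IsClosedLoopSolution

variable {N n m p m₀ l : ℕ}
  {G : Digraph (Fin (N + 1))} {S : Matrix (Fin m) (Fin m) ℝ} {C : Matrix (Fin n) (Fin m) ℝ}
  {P : Matrix (LeaderIdx m₀ l) (Fin m) ℝ} {R : Matrix (Fin m) (LeaderIdx m₀ l) ℝ}
  {sys : Fin N → EulerLagrangeSystem n} {Y : Fin N → RegressorFun n p} {Θ : Fin N → Fin p → ℝ}
  {g : Gains N n p} {ω : Fin l → ℝ} {J : Set ℝ} {v : ℝ → Fin m → ℝ}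
  {x : ℝ → Fin N → AgentState n p m₀ l}

theorem hasDerivWithinAt_leader (h : IsClosedLoopSolution G S C P R sys Y g J v x)
    (hn : IsNormalForm S ω P R) {t : ℝ} (ht : t ∈ J) :
    HasDerivWithinAt (fun s => P *ᵥ v s) (leaderMatrix m₀ ω *ᵥ (P *ᵥ v t)) J t := by
  rw [← hn.mul_mulVec]
  exact (h.leader t ht).const_mulVec P

theorem hasDerivWithinAt_leader_energy (h : IsClosedLoopSolution G S C P R sys Y g J v x)
    (hn : IsNormalForm S ω P R) {t : ℝ} (ht : t ∈ J) :
    HasDerivWithinAt (fun s => (P *ᵥ v s) ⬝ᵥ (P *ᵥ v s)) 0 J t := by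
  have h1 := h.hasDerivWithinAt_leader hn ht
  have h2 := dotProduct_mulVec_self_eq_zero_of_transpose_eq_neg (leaderMatrix_transpose ω)
    (P *ᵥ v t)
  have := h1.dotProduct h1
  rwa [dotProduct_comm, h2, add_zero] at this

/-- The error of the estimate of the leader's state. -/
def etaError (P : Matrix (LeaderIdx m₀ l) (Fin m) ℝ) (v : Fin m → ℝ)
    (x : Fin N → AgentState n p m₀ l) (i : Fin N) : LeaderIdx m₀ l → ℝ :=
  (x i).η - P *ᵥ v

/-- The rate of change of `etaError`. -/
noncomputable def etaErrorRate (G : Digraph (Fin (N + 1)))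
    (P : Matrix (LeaderIdx m₀ l) (Fin m) ℝ) (μ₁ : ℝ) (ω : Fin l → ℝ) (v : Fin m → ℝ) (x : Fin N → AgentState n p m₀ l) (i : Fin N) :
    LeaderIdx m₀ l → ℝ :=
  ControlLaw.etaRate μ₁ (x i) (neighborError G (P *ᵥ v) (fun j => (x j).η) i)
    - leaderMatrix m₀ ω *ᵥ (P *ᵥ v)

theorem hasDerivWithinAt_etaError (h : IsClosedLoopSolution G S C P R sys Y g J v x)
    (hn : IsNormalForm S ω P R) {t : ℝ} (ht : t ∈ J) (i : Fin N) :
    HasDerivWithinAt (fun s => etaError P (v s) (x s) i) (etaErrorRate G P g.μ₁ ω (v t) (x t) i) J t :=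
  (h.eta i t ht).sub (h.hasDerivWithinAt_leader hn ht)

/-- The Lyapunov function of the distributed observer: the Dirichlet form of the state errors plus
the weighted squares of the frequency errors. -/
noncomputable def observerEnergy (G : Digraph (Fin (N + 1)))
    (P : Matrix (LeaderIdx m₀ l) (Fin m) ℝ) (μ₂ : ℝ) (ω : Fin l → ℝ) (v : Fin m → ℝ)
    (x : Fin N → AgentState n p m₀ l) : ℝ :=
  -(∑ i, etaError P v x i ⬝ᵥ neighborError G 0 (etaError P v x) i)
    + μ₂⁻¹ * ∑ i, ((x i).ω - ω) ⬝ᵥ ((x i).ω - ω)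

/-- The rate of change of `observerEnergy` along solutions. -/
noncomputable def observerEnergyRate (G : Digraph (Fin (N + 1)))
    (P : Matrix (LeaderIdx m₀ l) (Fin m) ℝ) (μ₁ : ℝ) (v : Fin m → ℝ)
    (x : Fin N → AgentState n p m₀ l) : ℝ :=
  -(2 * μ₁) * ∑ i, neighborError G (P *ᵥ v) (fun j => (x j).η) i ⬝ᵥ
    neighborError G (P *ᵥ v) (fun j => (x j).η) i

theorem hasDerivWithinAt_observerEnergy (h : IsClosedLoopSolution G S C P R sys Y g J v x)
    (hn : IsNormalForm S ω P R) (hU : FollowersUndirected G) {t : ℝ} (ht : t ∈ J) :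
    HasDerivWithinAt (fun s => observerEnergy G P g.μ₂ ω (v s) (x s))
      (observerEnergyRate G P g.μ₁ (v t) (x t)) J t := by
  set ξ := etaError P (v t) (x t) with hξ
  set d := etaErrorRate G P g.μ₁ ω (v t) (x t) with hd
  set e := fun i => neighborError G (P *ᵥ v t) (fun j => (x t j).η) i with he
  have heξ : ∀ i, neighborError G 0 ξ i = e i := fun i => by
    exact (neighborError_eq_sub_leader G (P *ᵥ v t) (fun j => (x t j).η) i).symm
  have h1 : HasDerivWithinAt
      (fun s => ∑ i, etaError P (v s) (x s) i ⬝ᵥ neighborError G 0 (etaError P (v s) (x s)) i)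
      (∑ i, (d i ⬝ᵥ neighborError G 0 ξ i + ξ i ⬝ᵥ neighborError G 0 d i)) J t :=
    HasDerivWithinAt.fun_sum fun i _ => (h.hasDerivWithinAt_etaError hn ht i).dotProduct
      (HasDerivWithinAt.neighborError G (hasDerivWithinAt_const t J 0)
        (fun j => h.hasDerivWithinAt_etaError hn ht j) i)
  have hω : ∀ i, HasDerivWithinAt (fun s => (x s i).ω - ω)
      (ControlLaw.omegaRate g.μ₂ (x t i) (e i)) J t := fun i => (h.omega i t ht).sub_const ω
  have h2 : HasDerivWithinAt (fun s => ∑ i, ((x s i).ω - ω) ⬝ᵥ ((x s i).ω - ω))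
      (∑ i, (ControlLaw.omegaRate g.μ₂ (x t i) (e i) ⬝ᵥ ((x t i).ω - ω)
        + ((x t i).ω - ω) ⬝ᵥ ControlLaw.omegaRate g.μ₂ (x t i) (e i))) J t :=
    HasDerivWithinAt.fun_sum fun i _ => (hω i).dotProduct (hω i)
  convert! h1.neg.add (h2.const_mul g.μ₂⁻¹) using 1
  rw [Finset.sum_add_distrib, hU.sum_dotProduct_neighborError_comm ξ d]
  simp only [heξ]
  -- the common rotation of all errors does not change the Dirichlet form
  have hrot : ∑ i, (leaderMatrix m₀ ω *ᵥ ξ i) ⬝ᵥ e i = 0 := by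
    have h3 : ∑ i, (leaderMatrix m₀ ω *ᵥ ξ i) ⬝ᵥ e i
        = -∑ i, (leaderMatrix m₀ ω *ᵥ ξ i) ⬝ᵥ e i := by
      conv_lhs => simp only [← heξ]
      rw [hU.sum_dotProduct_neighborError_comm, ← Finset.sum_neg_distrib]
      refine Finset.sum_congr rfl fun i _ => ?_
      have h4 := mulVec_neighborError G (leaderMatrix m₀ ω) 0 ξ i
      rw [Matrix.mulVec_zero] at h4
      rw [← h4, heξ, Matrix.dotProduct_mulVec, ← Matrix.mulVec_transpose,
        leaderMatrix_transpose, Matrix.neg_mulVec, neg_dotProduct]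
    linarith
  have hdi : ∀ i, d i = leaderMatrix m₀ ω *ᵥ ξ i
      + leaderMatrix m₀ ((x t i).ω - ω) *ᵥ (x t i).η + g.μ₁ • e i := by
    intro i
    simp only [hd, hξ, etaErrorRate, etaError, ControlLaw.etaRate, he, leaderMatrix_sub,
      Matrix.sub_mulVec, Matrix.mulVec_sub]
    abel
  have hadj : ∀ i, (leaderMatrix m₀ ((x t i).ω - ω) *ᵥ (x t i).η) ⬝ᵥ e i
      = g.μ₂⁻¹ * (((x t i).ω - ω) ⬝ᵥ ControlLaw.omegaRate g.μ₂ (x t i) (e i)) := by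
    intro i
    rw [dotProduct_comm, dotProduct_leaderMatrix_mulVec, ControlLaw.omegaRate, dotProduct_smul,
      smul_eq_mul, inv_mul_cancel_left₀ g.μ₂_pos.ne']
  have hsum : ∑ i, d i ⬝ᵥ e i = g.μ₂⁻¹ * ∑ i,
      (((x t i).ω - ω) ⬝ᵥ ControlLaw.omegaRate g.μ₂ (x t i) (e i)) + g.μ₁ * ∑ i, e i ⬝ᵥ e i := by
    simp only [hdi, add_dotProduct, Finset.sum_add_distrib, smul_dotProduct, smul_eq_mul, hrot,
      hadj, Finset.mul_sum, zero_add]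
  have hcomm : ∀ i, ControlLaw.omegaRate g.μ₂ (x t i) (e i) ⬝ᵥ ((x t i).ω - ω)
      = ((x t i).ω - ω) ⬝ᵥ ControlLaw.omegaRate g.μ₂ (x t i) (e i) :=
    fun i => dotProduct_comm _ _
  simp only [hcomm, Finset.sum_add_distrib]
  rw [hsum, observerEnergyRate]
  ring

theorem hasDerivWithinAt_slide (h : IsClosedLoopSolution G S C P R sys Y g J v x) {t : ℝ}
    (ht : t ∈ J) (i : Fin N) {acc : Fin n → ℝ}
    (hacc : HasDerivWithinAt (fun s => (x s i).dq) acc J t) :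
    HasDerivWithinAt (fun s => ControlLaw.slide (C * R) g.α (x s i))
      (acc - ControlLaw.refAcc (C * R) g.α g.μ₁ g.μ₂ (x t i)
        (neighborError G (P *ᵥ v t) (fun j => (x t j).η) i)) J t := by
  have hη := h.eta i t ht
  have hS := HasDerivWithinAt.mulVec (fun a b =>
    hasDerivWithinAt_leaderMatrix (m₀ := m₀) (h.omega i t ht) a b) hη
  convert! hacc.sub ((hS.const_mulVec (C * R)).sub
    (((h.position i t ht).sub (hη.const_mulVec (C * R))).const_smul g.α)) using 2
  rw [ControlLaw.refAcc, Matrix.mulVec_add, add_comm ((C * R) *ᵥ (_ *ᵥ ControlLaw.etaRate _ _ _))]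

/-- The Lyapunov function of the adaptive tracking loop of follower `i`: the kinetic energy of the
sliding variable plus the weighted square of the parameter error. -/
noncomputable def trackingEnergy (C : Matrix (Fin n) (LeaderIdx m₀ l) ℝ)
    (sys : Fin N → EulerLagrangeSystem n) (g : Gains N n p) (Θ : Fin N → Fin p → ℝ)
    (x : Fin N → AgentState n p m₀ l) (i : Fin N) : ℝ :=
  ControlLaw.slide C g.α (x i) ⬝ᵥ ((sys i).M (x i).q *ᵥ ControlLaw.slide C g.α (x i))
    + ((x i).Θhat - Θ i) ⬝ᵥ (Matrix.diagonal (g.Λ i) *ᵥ ((x i).Θhat - Θ i))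

theorem hasDerivWithinAt_trackingEnergy (h : IsClosedLoopSolution G S C P R sys Y g J v x)
    (hY : ∀ i, IsRegressor (sys i) (Y i) (Θ i)) {t : ℝ} (ht : t ∈ J) (i : Fin N) :
    HasDerivWithinAt (fun s => trackingEnergy (C * R) sys g Θ (x s) i)
      (-2 * (ControlLaw.slide (C * R) g.α (x t i) ⬝ᵥ
        (g.K i *ᵥ ControlLaw.slide (C * R) g.α (x t i)))) J t := by
  obtain ⟨acc, hacc, hdyn⟩ := h.dynamics i t ht
  have hs := h.hasDerivWithinAt_slide ht i hacc
  set e := neighborError G (P *ᵥ v t) (fun j => (x t j).η) i with he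
  set s := ControlLaw.slide (C * R) g.α (x t i) with hsdef
  set r := ControlLaw.refAcc (C * R) g.α g.μ₁ g.μ₂ (x t i) e with hr
  set u := ControlLaw.refVel (C * R) g.α (x t i) with hu
  set M := (sys i).M (x t i).q with hM
  set Cm := (sys i).C (x t i).q (x t i).dq with hCm
  set Mdot := inertiaDot (sys i).M (x t i).q (x t i).dq with hMdot
  set Ym := ControlLaw.regressor (Y i) (C * R) g.α g.μ₁ g.μ₂ (x t i) e with hYm
  set θ := (x t i).Θhat - Θ i with hθ
  have hMd : ∀ a b, HasDerivWithinAt (fun s => (sys i).M (x s i).q a b) (Mdot a b) J t := by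
    intro a b
    have hd : HasFDerivAt (fun q => (sys i).M q a b) _ (x t i).q :=
      (((sys i).inertia_contDiff a b).differentiable one_ne_zero _).hasFDerivAt
    exact hd.comp_hasDerivWithinAt t (h.position i t ht)
  have h1 := hs.dotProduct (HasDerivWithinAt.mulVec hMd hs)
  have hθd : HasDerivWithinAt (fun s => (x s i).Θhat - Θ i)
      (ControlLaw.thetaRate g i (Y i) (C * R) (x t i) e) J t := (h.theta i t ht).sub_const _
  have h2 := hθd.dotProduct (hθd.const_mulVec (Matrix.diagonal (g.Λ i)))
  convert! h1.add h2 using 1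
  -- `M s' = -K s + Y θ - C s` along the closed loop
  have hMs : M *ᵥ (acc - r) = -(g.K i *ᵥ s) + Ym *ᵥ θ - Cm *ᵥ s := by
    have hreg : M *ᵥ r + Cm *ᵥ u + (sys i).G (x t i).q = Ym *ᵥ Θ i := (hY i).eq _ _ _ _
    have hdq : (x t i).dq = s + u := by rw [hsdef, ControlLaw.slide, ← hu]; abel
    have htau : M *ᵥ acc + Cm *ᵥ (s + u) + (sys i).G (x t i).q
        = -(g.K i *ᵥ s) + Ym *ᵥ (x t i).Θhat := by
      rw [← hdq]; exact hdyn
    rw [Matrix.mulVec_add] at htau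
    rw [hθ, Matrix.mulVec_sub, Matrix.mulVec_sub, ← hreg,
      eq_sub_of_add_eq (eq_sub_of_add_eq htau)]
    abel
  have hsymm : (acc - r) ⬝ᵥ (M *ᵥ s) = s ⬝ᵥ (M *ᵥ (acc - r)) := by
    rw [Matrix.dotProduct_mulVec, ← Matrix.mulVec_transpose, ((sys i).inertia_symm _).eq,
      dotProduct_comm]
  have hskew : s ⬝ᵥ (Mdot *ᵥ s) = 2 * (s ⬝ᵥ (Cm *ᵥ s)) := by
    have := dotProduct_mulVec_self_eq_zero_of_transpose_eq_neg
      ((sys i).skew (x t i).q (x t i).dq) s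
    rw [Matrix.sub_mulVec, Matrix.smul_mulVec, dotProduct_sub, dotProduct_smul,
      smul_eq_mul] at this
    linarith
  have hΛ : Matrix.diagonal (g.Λ i) *ᵥ ControlLaw.thetaRate g i (Y i) (C * R) (x t i) e
      = -(Ymᵀ *ᵥ s) := by
    have hdet : IsUnit (Matrix.diagonal (g.Λ i)).det := by
      rw [Matrix.det_diagonal]
      exact isUnit_iff_ne_zero.2 (Finset.prod_ne_zero_iff.2 fun k _ => (g.Λ_pos i k).ne')
    rw [ControlLaw.thetaRate, Matrix.mulVec_neg, Matrix.mulVec_mulVec,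
      Matrix.mul_nonsing_inv _ hdet, Matrix.one_mulVec]
  have hΛ' : ControlLaw.thetaRate g i (Y i) (C * R) (x t i) e ⬝ᵥ (Matrix.diagonal (g.Λ i) *ᵥ θ)
      = -(θ ⬝ᵥ (Ymᵀ *ᵥ s)) := by
    rw [Matrix.dotProduct_mulVec, ← Matrix.mulVec_transpose, Matrix.diagonal_transpose, hΛ,
      neg_dotProduct, dotProduct_comm]
  have hYs : θ ⬝ᵥ (Ymᵀ *ᵥ s) = s ⬝ᵥ (Ym *ᵥ θ) := by
    rw [Matrix.dotProduct_mulVec, Matrix.vecMul_transpose, dotProduct_comm]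
  rw [hΛ', hΛ, dotProduct_neg, hYs, hsymm, dotProduct_add, hskew, hMs, dotProduct_sub,
    dotProduct_add, dotProduct_neg]
  ring

/-- The output error against the follower's own estimate of the leader's output obeys a stable
linear filter driven by the sliding variable and the neighbour error. -/
theorem outputErrorRate_eq (C : Matrix (Fin n) (LeaderIdx m₀ l) ℝ) (α μ₁ : ℝ)
    (z : AgentState n p m₀ l) (e : LeaderIdx m₀ l → ℝ) :
    z.dq - C *ᵥ ControlLaw.etaRate μ₁ z e
      = -α • (z.q - C *ᵥ z.η) + (ControlLaw.slide C α z - μ₁ • (C *ᵥ e)) := by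
  rw [ControlLaw.slide, ControlLaw.refVel, ControlLaw.etaRate, Matrix.mulVec_add,
    Matrix.mulVec_smul, neg_smul]
  abel

theorem hasDerivWithinAt_outputError (h : IsClosedLoopSolution G S C P R sys Y g J v x) {t : ℝ}
    (ht : t ∈ J) (i : Fin N) :
    HasDerivWithinAt (fun s => (x s i).q - (C * R) *ᵥ (x s i).η)
      (-g.α • ((x t i).q - (C * R) *ᵥ (x t i).η)
        + (ControlLaw.slide (C * R) g.α (x t i) - g.μ₁ • ((C * R) *ᵥ
          neighborError G (P *ᵥ v t) (fun j => (x t j).η) i))) J t := by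
  rw [← outputErrorRate_eq]
  exact (h.position i t ht).sub ((h.eta i t ht).const_mulVec (C * R))

end IsClosedLoopSolution

/-! ### A priori bounds -/

theorem Continuous.exists_bound_of_norm_le {E F : Type*} [NormedAddCommGroup E] [ProperSpace E]
    [SeminormedAddCommGroup F] {f : E → F} (hf : Continuous f) (B : ℝ) :
    ∃ B' : ℝ, ∀ x, ‖x‖ ≤ B → ‖f x‖ ≤ B' := by
  obtain ⟨B', h⟩ := (isCompact_closedBall (0 : E) B).exists_bound_of_continuousOn hf.continuousOn
  exact ⟨B', fun x hx => h x (by simpa using hx)⟩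

theorem AgentState.norm_toFlat_le_iff {n p m₀ l : ℕ} {a : AgentState n p m₀ l} {B : ℝ} :
    ‖a.toFlat‖ ≤ B ↔ ‖a.q‖ ≤ B ∧ ‖a.dq‖ ≤ B ∧ ‖a.Θhat‖ ≤ B ∧ ‖a.η‖ ≤ B ∧ ‖a.ω‖ ≤ B := by
  simp [AgentState.toFlat]

/-- A solution of the closed loop with prescribed initial values on an interval `J ⊆ [0, ∞)` that
contains `0`. -/
structure IsForwardSolution {N n m p m₀ l : ℕ} (G : Digraph (Fin (N + 1)))
    (S : Matrix (Fin m) (Fin m) ℝ) (C : Matrix (Fin n) (Fin m) ℝ)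
    (P : Matrix (LeaderIdx m₀ l) (Fin m) ℝ) (R : Matrix (Fin m) (LeaderIdx m₀ l) ℝ)
    (sys : Fin N → EulerLagrangeSystem n) (Y : Fin N → RegressorFun n p) (g : Gains N n p)
    (v₀ : Fin m → ℝ) (x₀ : Fin N → AgentState n p m₀ l)
    (J : Set ℝ) (v : ℝ → Fin m → ℝ) (x : ℝ → Fin N → AgentState n p m₀ l) : Prop
    extends IsClosedLoopSolution G S C P R sys Y g J v x where
  convex : Convex ℝ J
  zero_mem : 0 ∈ J
  nonneg : ∀ t ∈ J, 0 ≤ t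
  leader_init : v 0 = v₀
  agents_init : x 0 = x₀

section Bounds

variable {N n m p m₀ l : ℕ}
  {G : Digraph (Fin (N + 1))} {S : Matrix (Fin m) (Fin m) ℝ} {C : Matrix (Fin n) (Fin m) ℝ}
  {P : Matrix (LeaderIdx m₀ l) (Fin m) ℝ} {R : Matrix (Fin m) (LeaderIdx m₀ l) ℝ}
  {sys : Fin N → EulerLagrangeSystem n} {Y : Fin N → RegressorFun n p} {Θ : Fin N → Fin p → ℝ}
  {g : Gains N n p} {ω : Fin l → ℝ} {v₀ : Fin m → ℝ} {x₀ : Fin N → AgentState n p m₀ l}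

open IsClosedLoopSolution

theorem dotProduct_self_nonneg_real {ι : Type*} [Fintype ι] (x : ι → ℝ) : 0 ≤ x ⬝ᵥ x :=
  (sq_nonneg _).trans (norm_sq_le_dotProduct_self x)

theorem IsForwardSolution.norm_leader_le {J : Set ℝ} {v : ℝ → Fin m → ℝ}
    {x : ℝ → Fin N → AgentState n p m₀ l}
    (h : IsForwardSolution G S C P R sys Y g v₀ x₀ J v x) (hn : IsNormalForm S ω P R) {t : ℝ}
    (ht : t ∈ J) : ‖P *ᵥ v t‖ ≤ √((P *ᵥ v₀) ⬝ᵥ (P *ᵥ v₀)) := by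
  have hanti := antitoneOn_of_hasDerivWithinAt_of_nonpos h.convex
    (fun t ht => h.hasDerivWithinAt_leader_energy hn ht) (fun _ _ => le_rfl)
  have h1 := hanti h.zero_mem ht (h.nonneg t ht)
  simp only [h.leader_init] at h1
  exact Real.le_sqrt_of_sq_le ((norm_sq_le_dotProduct_self _).trans h1)

theorem observerEnergyRate_nonpos {μ₁ : ℝ} (hμ : 0 < μ₁) (v : Fin m → ℝ)
    (x : Fin N → AgentState n p m₀ l) : observerEnergyRate G P μ₁ v x ≤ 0 :=
  mul_nonpos_of_nonpos_of_nonneg (by linarith)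
    (Finset.sum_nonneg fun _ _ => dotProduct_self_nonneg_real _)

theorem antitoneOn_observerEnergy {J : Set ℝ} {v : ℝ → Fin m → ℝ}
    {x : ℝ → Fin N → AgentState n p m₀ l}
    (h : IsForwardSolution G S C P R sys Y g v₀ x₀ J v x) (hn : IsNormalForm S ω P R)
    (hU : FollowersUndirected G) :
    AntitoneOn (fun t => observerEnergy G P g.μ₂ ω (v t) (x t)) J :=
  antitoneOn_of_hasDerivWithinAt_of_nonpos h.convex
    (fun _ ht => h.hasDerivWithinAt_observerEnergy hn hU ht)
    (fun t _ => observerEnergyRate_nonpos g.μ₁_pos (v t) (x t))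

theorem observerEnergy_nonneg_terms (hG : HasLeaderSpanningTree G) (hU : FollowersUndirected G)
    (g : Gains N n p) (v : Fin m → ℝ) (x : Fin N → AgentState n p m₀ l) :
    0 ≤ -(∑ i, etaError P v x i ⬝ᵥ neighborError G 0 (etaError P v x) i) ∧
      0 ≤ g.μ₂⁻¹ * ∑ i, ((x i).ω - ω) ⬝ᵥ ((x i).ω - ω) := by
  obtain ⟨c, hc, h⟩ := hG.exists_pos_mul_norm_sq_le (m₀ := m₀) (l := l) hU
  exact ⟨le_trans (by positivity) (h _), mul_nonneg (inv_nonneg.2 g.μ₂_pos.le)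
    (Finset.sum_nonneg fun _ _ => dotProduct_self_nonneg_real _)⟩

theorem exists_bound_observer (hn : IsNormalForm S ω P R) (hG : HasLeaderSpanningTree G)
    (hU : FollowersUndirected G) (v₀ : Fin m → ℝ) (x₀ : Fin N → AgentState n p m₀ l) :
    ∃ B : ℝ, ∀ J v x, IsForwardSolution G S C P R sys Y g v₀ x₀ J v x → ∀ t ∈ J,
      ‖fun i => (x t i).η‖ ≤ B ∧ ∀ i, ‖(x t i).ω‖ ≤ B := by
  obtain ⟨c, hc, hQ⟩ := hG.exists_pos_mul_norm_sq_le (m₀ := m₀) (l := l) hU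
  set V := observerEnergy G P g.μ₂ ω v₀ x₀ with hV
  set Bw := √((P *ᵥ v₀) ⬝ᵥ (P *ᵥ v₀)) with hBw
  refine ⟨max (√(V / c) + Bw) (√(V / g.μ₂⁻¹) + ‖ω‖), fun J v x h t ht => ?_⟩
  have hVt := antitoneOn_observerEnergy h hn hU h.zero_mem ht (h.nonneg t ht)
  simp only [h.leader_init, h.agents_init, ← hV] at hVt
  rw [observerEnergy] at hVt
  obtain ⟨h1, h2⟩ := observerEnergy_nonneg_terms (P := P) (ω := ω) hG hU g (v t) (x t)
  refine ⟨le_max_of_le_left ?_, fun i => le_max_of_le_right ?_⟩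
  · have h3 := norm_le_sqrt_of_mul_sq_le hc
      ((hQ (etaError P (v t) (x t))).trans (by linarith : _ ≤ V))
    refine (pi_norm_le_iff_of_nonneg (by positivity)).2 fun i => ?_
    have h4 : (x t i).η = etaError P (v t) (x t) i + P *ᵥ v t := by rw [etaError]; abel
    rw [h4]
    exact (norm_add_le _ _).trans (add_le_add ((norm_le_pi_norm _ i).trans h3)
      (h.norm_leader_le hn ht))
  · have h3 : g.μ₂⁻¹ * ‖(x t i).ω - ω‖ ^ 2 ≤ V := by
      have h4 : ‖(x t i).ω - ω‖ ^ 2 ≤ ∑ i, ((x t i).ω - ω) ⬝ᵥ ((x t i).ω - ω) :=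
        (norm_sq_le_dotProduct_self _).trans
          (Finset.single_le_sum (f := fun i => ((x t i).ω - ω) ⬝ᵥ ((x t i).ω - ω))
            (fun _ _ => dotProduct_self_nonneg_real _) (Finset.mem_univ i))
      have := mul_le_mul_of_nonneg_left h4 (inv_nonneg.2 g.μ₂_pos.le)
      linarith
    have h5 := norm_le_sqrt_of_mul_sq_le (inv_pos.2 g.μ₂_pos) h3
    have h6 : (x t i).ω = ((x t i).ω - ω) + ω := by abel
    rw [h6]
    exact (norm_add_le _ _).trans (add_le_add h5 le_rfl)

theorem antitoneOn_trackingEnergy {J : Set ℝ} {v : ℝ → Fin m → ℝ}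
    {x : ℝ → Fin N → AgentState n p m₀ l}
    (h : IsForwardSolution G S C P R sys Y g v₀ x₀ J v x)
    (hY : ∀ i, IsRegressor (sys i) (Y i) (Θ i)) (i : Fin N) :
    AntitoneOn (fun t => trackingEnergy (C * R) sys g Θ (x t) i) J := by
  obtain ⟨c, hc, hK⟩ := (g.K_pos i).exists_pos_mul_norm_sq_le
  refine antitoneOn_of_hasDerivWithinAt_of_nonpos h.convex
    (fun t ht => h.hasDerivWithinAt_trackingEnergy hY ht i) fun t _ => ?_
  have := (mul_nonneg hc.le (sq_nonneg _)).trans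
    (hK (ControlLaw.slide (C * R) g.α (x t i)))
  linarith

/-- The tracking energy dominates the squared norms of the sliding variable and of the parameter
error, uniformly in the configuration, since the inertia is uniformly positive definite. -/
theorem exists_trackingEnergy_coercive (sys : Fin N → EulerLagrangeSystem n) (g : Gains N n p)
    (C : Matrix (Fin n) (LeaderIdx m₀ l) ℝ) (Θ : Fin N → Fin p → ℝ) (i : Fin N) :
    ∃ c c' : ℝ, 0 < c ∧ 0 < c' ∧ ∀ x : Fin N → AgentState n p m₀ l,
      c * ‖ControlLaw.slide C g.α (x i)‖ ^ 2 + c' * ‖(x i).Θhat - Θ i‖ ^ 2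
        ≤ trackingEnergy C sys g Θ x i := by
  obtain ⟨c, hc, hM⟩ := (sys i).inertia_pos
  obtain ⟨c', hc', hL⟩ :=
    (Matrix.PosDef.diagonal (d := g.Λ i) (g.Λ_pos i)).exists_pos_mul_norm_sq_le
  refine ⟨c, c', hc, hc', fun x => add_le_add (le_trans ?_ (hM _ _)) (hL _)⟩
  exact mul_le_mul_of_nonneg_left (norm_sq_le_dotProduct_self _) hc.le

theorem exists_bound_tracking (hY : ∀ i, IsRegressor (sys i) (Y i) (Θ i)) (v₀ : Fin m → ℝ)
    (x₀ : Fin N → AgentState n p m₀ l) (i : Fin N) :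
    ∃ B : ℝ, ∀ J v x, IsForwardSolution G S C P R sys Y g v₀ x₀ J v x → ∀ t ∈ J,
      ‖ControlLaw.slide (C * R) g.α (x t i)‖ ≤ B ∧ ‖(x t i).Θhat‖ ≤ B := by
  obtain ⟨c, c', hc, hc', hQ⟩ := exists_trackingEnergy_coercive sys g (C * R) Θ i
  set V := trackingEnergy (C * R) sys g Θ x₀ i with hV
  refine ⟨max √(V / c) (√(V / c') + ‖Θ i‖), fun J v x h t ht => ?_⟩
  have hVt := antitoneOn_trackingEnergy h hY i h.zero_mem ht (h.nonneg t ht)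
  simp only [h.agents_init, ← hV] at hVt
  have h1 := hQ (x t)
  have h2 : 0 ≤ c * ‖ControlLaw.slide (C * R) g.α (x t i)‖ ^ 2 := by positivity
  have h3 : 0 ≤ c' * ‖(x t i).Θhat - Θ i‖ ^ 2 := by positivity
  refine ⟨le_max_of_le_left (norm_le_sqrt_of_mul_sq_le hc (by linarith)),
    le_max_of_le_right ?_⟩
  have h4 := norm_le_sqrt_of_mul_sq_le hc' (by linarith : c' * ‖(x t i).Θhat - Θ i‖ ^ 2 ≤ V)
  have h5 : (x t i).Θhat = ((x t i).Θhat - Θ i) + Θ i := by abel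
  rw [h5]
  exact (norm_add_le _ _).trans (add_le_add h4 le_rfl)

theorem exists_bound_outputError (hn : IsNormalForm S ω P R) (hG : HasLeaderSpanningTree G)
    (hU : FollowersUndirected G) (hY : ∀ i, IsRegressor (sys i) (Y i) (Θ i)) (v₀ : Fin m → ℝ)
    (x₀ : Fin N → AgentState n p m₀ l) (i : Fin N) :
    ∃ B : ℝ, ∀ J v x, IsForwardSolution G S C P R sys Y g v₀ x₀ J v x → ∀ t ∈ J,
      ‖(x t i).q - (C * R) *ᵥ (x t i).η‖ ≤ B := by
  obtain ⟨B₁, hB₁⟩ := exists_bound_observer (C := C) (sys := sys) (Y := Y) (g := g) hn hG hU v₀ x₀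
  obtain ⟨B₂, hB₂⟩ := exists_bound_tracking (G := G) (S := S) (C := C) (P := P) (R := R)
    (g := g) hY v₀ x₀ i
  -- the input of the filter is a continuous function of bounded quantities
  have hcont : Continuous fun z : (Fin n → ℝ) × (LeaderIdx m₀ l → ℝ) ×
      (Fin N → LeaderIdx m₀ l → ℝ) =>
      z.1 - g.μ₁ • ((C * R) *ᵥ neighborError G z.2.1 z.2.2 i) := by
    have he : Continuous fun z : (Fin n → ℝ) × (LeaderIdx m₀ l → ℝ) ×
        (Fin N → LeaderIdx m₀ l → ℝ) => neighborError G z.2.1 z.2.2 i := by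
      simp only [neighborError_eq]
      fun_prop
    exact continuous_fst.sub ((Continuous.matrix_mulVec continuous_const he).const_smul g.μ₁)
  obtain ⟨β, hβ⟩ := hcont.exists_bound_of_norm_le
    (max B₂ (max (√((P *ᵥ v₀) ⬝ᵥ (P *ᵥ v₀))) B₁))
  refine ⟨β / g.α + ‖(x₀ i).q - (C * R) *ᵥ (x₀ i).η‖, fun J v x h t ht => ?_⟩
  have hb : ∀ t ∈ J, ‖ControlLaw.slide (C * R) g.α (x t i) - g.μ₁ • ((C * R) *ᵥ
      neighborError G (P *ᵥ v t) (fun j => (x t j).η) i)‖ ≤ β := by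
    intro t ht
    refine hβ (ControlLaw.slide (C * R) g.α (x t i), P *ᵥ v t, fun j => (x t j).η) ?_
    rw [norm_prod_le_iff, norm_prod_le_iff]
    exact ⟨le_max_of_le_left (hB₂ J v x h t ht).1,
      le_max_of_le_right (le_max_of_le_left (h.norm_leader_le hn ht)),
      le_max_of_le_right (le_max_of_le_right (hB₁ J v x h t ht).1)⟩
  have hβ0 : 0 ≤ β := (norm_nonneg _).trans (hb t ht)
  have hαp := g.α_pos
  refine (pi_norm_le_iff_of_nonneg (by positivity)).2 fun k => ?_
  have hd : ∀ s ∈ J, HasDerivWithinAt (fun s => ((x s i).q - (C * R) *ᵥ (x s i).η) k)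
      (-g.α * ((x s i).q - (C * R) *ᵥ (x s i).η) k
        + (ControlLaw.slide (C * R) g.α (x s i) - g.μ₁ • ((C * R) *ᵥ
          neighborError G (P *ᵥ v s) (fun j => (x s j).η) i)) k) J s := fun s hs =>
    hasDerivWithinAt_pi.1 (h.hasDerivWithinAt_outputError hs i) k
  have h1 := abs_le_of_hasDerivWithinAt_linear g.α_pos h.convex h.zero_mem hd
    (fun s hs _ => (norm_le_pi_norm _ k).trans (hb s hs)) ht (h.nonneg t ht)
  refine h1.trans (add_le_add le_rfl ?_)
  rw [h.agents_init]
  have h2 : Real.exp (-g.α * (t - 0)) ≤ 1 := Real.exp_le_one_iff.2 (by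
    nlinarith [mul_nonneg hαp.le (h.nonneg t ht)])
  exact (mul_le_of_le_one_left (abs_nonneg _) h2).trans
    (norm_le_pi_norm ((x₀ i).q - (C * R) *ᵥ (x₀ i).η) k)

/-- The state of the closed loop is bounded by a constant that depends on the initial values, but
not on the interval on which the solution is considered. -/
theorem exists_bound_flatCurve (hn : IsNormalForm S ω P R) (hG : HasLeaderSpanningTree G)
    (hU : FollowersUndirected G) (hY : ∀ i, IsRegressor (sys i) (Y i) (Θ i)) (v₀ : Fin m → ℝ)
    (x₀ : Fin N → AgentState n p m₀ l) :
    ∃ B : ℝ, ∀ J v x, IsForwardSolution G S C P R sys Y g v₀ x₀ J v x → ∀ t ∈ J,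
      ‖flatCurve v x t‖ ≤ B := by
  obtain ⟨B₁, hB₁⟩ := exists_bound_observer (C := C) (sys := sys) (Y := Y) (g := g) hn hG hU v₀ x₀
  have hagent : ∀ i, ∃ B : ℝ, ∀ J v x, IsForwardSolution G S C P R sys Y g v₀ x₀ J v x →
      ∀ t ∈ J, ‖(x t i).toFlat‖ ≤ B := by
    intro i
    obtain ⟨B₂, hB₂⟩ := exists_bound_tracking (G := G) (S := S) (C := C) (P := P) (R := R)
      (g := g) hY v₀ x₀ i
    obtain ⟨B₃, hB₃⟩ := exists_bound_outputError (C := C) (g := g) hn hG hU hY v₀ x₀ i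
    obtain ⟨B₄, hB₄⟩ := (Continuous.matrix_mulVec continuous_const continuous_id :
      Continuous fun η : LeaderIdx m₀ l → ℝ => (C * R) *ᵥ η).exists_bound_of_norm_le B₁
    have hcont : Continuous fun z : FlatState n p m₀ l =>
        ControlLaw.refVel (C * R) g.α (AgentState.ofFlat z) := by
      have ha : LocallyLipschitz fun z : FlatState n p m₀ l => (AgentState.ofFlat z).toFlat :=
        LocallyLipschitz.id
      exact (locallyLipschitz_refVel _ _ (locallyLipschitz_q ha) (locallyLipschitz_η ha)
        (locallyLipschitz_ω ha)).continuous
    obtain ⟨B₅, hB₅⟩ := hcont.exists_bound_of_norm_le (max (B₃ + B₄) B₁)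
    refine ⟨max (B₃ + B₄) (max (B₂ + B₅) (max B₂ B₁)), fun J v x h t ht => ?_⟩
    obtain ⟨hη, hω⟩ := hB₁ J v x h t ht
    obtain ⟨hs, hΘ⟩ := hB₂ J v x h t ht
    have hηi : ‖(x t i).η‖ ≤ B₁ := (norm_le_pi_norm (fun i => (x t i).η) i).trans hη
    have hB₁0 : 0 ≤ B₁ := (norm_nonneg _).trans hη
    have hq : ‖(x t i).q‖ ≤ B₃ + B₄ := by
      have e : (x t i).q = ((x t i).q - (C * R) *ᵥ (x t i).η) + (C * R) *ᵥ (x t i).η := by abel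
      rw [e]
      exact (norm_add_le _ _).trans (add_le_add (hB₃ J v x h t ht) (hB₄ _ hηi))
    have hdq : ‖(x t i).dq‖ ≤ B₂ + B₅ := by
      have e : (x t i).dq = ControlLaw.slide (C * R) g.α (x t i)
          + ControlLaw.refVel (C * R) g.α (x t i) := by rw [ControlLaw.slide]; abel
      rw [e]
      refine (norm_add_le _ _).trans (add_le_add hs ?_)
      -- the reference velocity does not depend on the velocity and on the parameter estimate
      refine hB₅ ((x t i).q, 0, 0, (x t i).η, (x t i).ω) ?_
      simp only [norm_prod_le_iff, norm_zero]
      exact ⟨le_max_of_le_left hq, le_max_of_le_right hB₁0, le_max_of_le_right hB₁0,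
        le_max_of_le_right hηi, le_max_of_le_right (hω i)⟩
    rw [AgentState.norm_toFlat_le_iff]
    exact ⟨le_max_of_le_left hq, le_max_of_le_right (le_max_of_le_left hdq),
      le_max_of_le_right (le_max_of_le_right (le_max_of_le_left hΘ)),
      le_max_of_le_right (le_max_of_le_right (le_max_of_le_right hηi)),
      le_max_of_le_right (le_max_of_le_right (le_max_of_le_right (hω i)))⟩
  choose b hb using hagent
  obtain ⟨B₆, hB₆⟩ := (Continuous.matrix_mulVec continuous_const continuous_id :
    Continuous fun w : LeaderIdx m₀ l → ℝ => R *ᵥ w).exists_bound_of_norm_le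
      (√((P *ᵥ v₀) ⬝ᵥ (P *ᵥ v₀)))
  refine ⟨max B₆ (∑ i, |b i|), fun J v x h t ht => ?_⟩
  rw [norm_prod_le_iff]
  refine ⟨le_max_of_le_left ?_, le_max_of_le_right ?_⟩
  · have := hB₆ _ (h.norm_leader_le hn ht)
    rwa [hn.mulVec_mulVec_self] at this
  · refine (pi_norm_le_iff_of_nonneg (Finset.sum_nonneg fun _ _ => abs_nonneg _)).2 fun i => ?_
    exact (hb i J v x h t ht).trans ((le_abs_self _).trans
      (Finset.single_le_sum (f := fun i => |b i|) (fun _ _ => abs_nonneg _) (Finset.mem_univ i)))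

theorem exists_solution_Ici (hn : IsNormalForm S ω P R) (hG : HasLeaderSpanningTree G)
    (hU : FollowersUndirected G) (hY : ∀ i, IsRegressor (sys i) (Y i) (Θ i)) (v₀ : Fin m → ℝ)
    (x₀ : Fin N → AgentState n p m₀ l) :
    ∃ v x, IsForwardSolution G S C P R sys Y g v₀ x₀ (Ici 0) v x := by
  obtain ⟨B, hB⟩ := exists_bound_flatCurve (C := C) (g := g) hn hG hU hY v₀ x₀
  obtain ⟨z, hz0, hz⟩ := (locallyLipschitz_closedLoopField (G := G) (S := S) (C := C) (P := P)
    (R := R) (g := g) hY).exists_global_solution (v₀, fun i => (x₀ i).toFlat) (B := B)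
    fun T hT z hz0 hz => hB (Ico 0 T) (fun t => (z t).1)
      (fun t i => AgentState.ofFlat ((z t).2 i))
      { toIsClosedLoopSolution := isClosedLoopSolution_of_hasDerivWithinAt hz
        convex := convex_Ico 0 T
        zero_mem := ⟨le_rfl, hT⟩
        nonneg := fun t ht => ht.1
        leader_init := by rw [hz0]
        agents_init := by rw [hz0]; rfl }
  exact ⟨fun t => (z t).1, fun t i => AgentState.ofFlat ((z t).2 i),
    { toIsClosedLoopSolution := isClosedLoopSolution_of_hasDerivWithinAt hz
      convex := convex_Ici 0
      zero_mem := mem_Ici.2 le_rfl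
      nonneg := fun t ht => ht
      leader_init := by rw [hz0]
      agents_init := by rw [hz0]; rfl }⟩

theorem IsClosedLoopSolution.eqOn (hY : ∀ i, IsRegressor (sys i) (Y i) (Θ i)) {T : ℝ}
    {v v' : ℝ → Fin m → ℝ} {x x' : ℝ → Fin N → AgentState n p m₀ l}
    (h : IsClosedLoopSolution G S C P R sys Y g (Ico 0 T) v x)
    (h' : IsClosedLoopSolution G S C P R sys Y g (Ico 0 T) v' x') (hv : v 0 = v' 0)
    (hx : x 0 = x' 0) {t : ℝ} (ht : t ∈ Ico 0 T) : v t = v' t ∧ x t = x' t := by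
  have h1 := (locallyLipschitz_closedLoopField (G := G) (S := S) (C := C) (P := P)
    (R := R) (g := g) hY).solution_unique (x := flatCurve v x) (y := flatCurve v' x')
    (by simp only [flatCurve, hv, hx]) (fun _ ht => h.hasDerivWithinAt_flatCurve ht)
    (fun _ ht => h'.hasDerivWithinAt_flatCurve ht) ht
  refine ⟨congrArg Prod.fst h1, funext fun i => ?_⟩
  exact congrArg AgentState.ofFlat (congrFun (congrArg Prod.snd h1) i)

theorem IsClosedLoopSolution.mono {J J' : Set ℝ} (hJ : J' ⊆ J) {v : ℝ → Fin m → ℝ}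
    {x : ℝ → Fin N → AgentState n p m₀ l} (h : IsClosedLoopSolution G S C P R sys Y g J v x) :
    IsClosedLoopSolution G S C P R sys Y g J' v x :=
  isClosedLoopSolution_of_hasDerivWithinAt fun _ ht =>
    (h.hasDerivWithinAt_flatCurve (hJ ht)).mono hJ

end Bounds

/-! ### Convergence -/

theorem tendsto_zero_of_mul_norm_sq_le {E : Type*} [SeminormedAddCommGroup E] {f : ℝ → E}
    {V : ℝ → ℝ} {c : ℝ} (hc : 0 < c) (h : ∀ᶠ t in atTop, c * ‖f t‖ ^ 2 ≤ V t)
    (hV : Tendsto V atTop (𝓝 0)) : Tendsto f atTop (𝓝 0) := by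
  have h1 : Tendsto (fun t => √(V t / c)) atTop (𝓝 0) := by
    simpa using (hV.div_const c).sqrt
  exact squeeze_zero_norm' (h.mono fun t ht => norm_le_sqrt_of_mul_sq_le hc ht) h1

theorem tendsto_zero_mul_of_bounded {f u : ℝ → ℝ} {B : ℝ} (hf : ∀ᶠ t in atTop, |f t| ≤ B)
    (hu : Tendsto u atTop (𝓝 0)) : Tendsto (fun t => f t * u t) atTop (𝓝 0) := by
  have h1 : Tendsto (fun t => B * |u t|) atTop (𝓝 0) := by simpa using (hu.abs).const_mul B
  refine squeeze_zero_norm' (hf.mono fun t ht => ?_) h1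
  rw [Real.norm_eq_abs, abs_mul]
  exact mul_le_mul_of_nonneg_right ht (abs_nonneg _)

namespace IsForwardSolution

variable {N n m p m₀ l : ℕ}
  {G : Digraph (Fin (N + 1))} {S : Matrix (Fin m) (Fin m) ℝ} {C : Matrix (Fin n) (Fin m) ℝ}
  {P : Matrix (LeaderIdx m₀ l) (Fin m) ℝ} {R : Matrix (Fin m) (LeaderIdx m₀ l) ℝ}
  {sys : Fin N → EulerLagrangeSystem n} {Y : Fin N → RegressorFun n p} {Θ : Fin N → Fin p → ℝ}
  {g : Gains N n p} {ω : Fin l → ℝ} {v₀ : Fin m → ℝ} {x₀ : Fin N → AgentState n p m₀ l}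
  {v : ℝ → Fin m → ℝ} {x : ℝ → Fin N → AgentState n p m₀ l}

open IsClosedLoopSolution

theorem exists_bound (h : IsForwardSolution G S C P R sys Y g v₀ x₀ (Ici 0) v x)
    (hn : IsNormalForm S ω P R) (hG : HasLeaderSpanningTree G) (hU : FollowersUndirected G)
    (hY : ∀ i, IsRegressor (sys i) (Y i) (Θ i)) :
    ∃ B : ℝ, ∀ t ∈ Ici (0 : ℝ), ‖flatCurve v x t‖ ≤ B := by
  obtain ⟨B, hB⟩ := exists_bound_flatCurve (C := C) (g := g) hn hG hU hY v₀ x₀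
  exact ⟨B, hB (Ici 0) v x h⟩

/-- Barbalat's lemma for the closed loop: a convergent quantity whose rate of change is a continuous
function of the state settles. -/
theorem tendsto_rate (h : IsForwardSolution G S C P R sys Y g v₀ x₀ (Ici 0) v x)
    (hn : IsNormalForm S ω P R) (hG : HasLeaderSpanningTree G) (hU : FollowersUndirected G)
    (hY : ∀ i, IsRegressor (sys i) (Y i) (Θ i)) {F : ℝ → ℝ}
    {φ : (Fin m → ℝ) → (Fin N → AgentState n p m₀ l) → ℝ}
    (hφ : Continuous fun z : (Fin m → ℝ) × (Fin N → FlatState n p m₀ l) =>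
      φ z.1 fun i => AgentState.ofFlat (z.2 i))
    (hF : ∀ t ∈ Ici 0, HasDerivWithinAt F (φ (v t) (x t)) (Ici 0) t) {c : ℝ}
    (hc : Tendsto F atTop (𝓝 c)) : Tendsto (fun t => φ (v t) (x t)) atTop (𝓝 0) := by
  obtain ⟨B, hB⟩ := h.exists_bound hn hG hU hY
  exact tendsto_zero_of_hasDerivWithinAt_comp
    (locallyLipschitz_closedLoopField (G := G) (S := S) (C := C) (P := P) (R := R) (g := g)
      hY).continuous (fun t ht => h.hasDerivWithinAt_flatCurve ht) hB hφ hF hc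

theorem tendsto_neighborError (h : IsForwardSolution G S C P R sys Y g v₀ x₀ (Ici 0) v x)
    (hn : IsNormalForm S ω P R) (hG : HasLeaderSpanningTree G) (hU : FollowersUndirected G)
    (hY : ∀ i, IsRegressor (sys i) (Y i) (Θ i)) (i : Fin N) :
    Tendsto (fun t => neighborError G (P *ᵥ v t) (fun j => (x t j).η) i) atTop (𝓝 0) := by
  obtain ⟨c, hc⟩ := (antitoneOn_observerEnergy h hn hU).exists_tendsto_atTop_of_bddBelow (b := 0)
    fun t _ => by
      obtain ⟨h1, h2⟩ := observerEnergy_nonneg_terms (P := P) (ω := ω) hG hU g (v t) (x t)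
      exact add_nonneg h1 h2
  have hcont : Continuous fun z : (Fin m → ℝ) × (Fin N → FlatState n p m₀ l) =>
      observerEnergyRate G P g.μ₁ z.1 fun i => AgentState.ofFlat (z.2 i) := by
    have he := fun i => (locallyLipschitz_neighborError_snd (n := n) (p := p) G P i).continuous
    exact continuous_const.mul (continuous_finsetSum _ fun i _ => (he i).dotProduct (he i))
  have hlim := h.tendsto_rate hn hG hU hY hcont
    (fun t ht => h.hasDerivWithinAt_observerEnergy hn hU ht) hc
  have hμ := g.μ₁_pos
  refine tendsto_zero_of_mul_norm_sq_le (c := 2 * g.μ₁) (by positivity)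
    (Eventually.of_forall fun t => ?_) (by simpa using hlim.neg)
  rw [observerEnergyRate, neg_mul, neg_neg]
  refine mul_le_mul_of_nonneg_left ((norm_sq_le_dotProduct_self _).trans ?_) (by positivity)
  exact Finset.single_le_sum (f := fun i => neighborError G (P *ᵥ v t) (fun j => (x t j).η) i ⬝ᵥ
    neighborError G (P *ᵥ v t) (fun j => (x t j).η) i)
    (fun _ _ => dotProduct_self_nonneg_real _) (Finset.mem_univ i)

theorem tendsto_etaError (h : IsForwardSolution G S C P R sys Y g v₀ x₀ (Ici 0) v x)
    (hn : IsNormalForm S ω P R) (hG : HasLeaderSpanningTree G) (hU : FollowersUndirected G)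
    (hY : ∀ i, IsRegressor (sys i) (Y i) (Θ i)) :
    Tendsto (fun t => etaError P (v t) (x t)) atTop (𝓝 0) := by
  obtain ⟨c, hc, hQ⟩ := hG.exists_pos_mul_norm_sq_le (m₀ := m₀) (l := l) hU
  obtain ⟨B, hB⟩ := h.exists_bound hn hG hU hY
  have hcont : Continuous fun z : (Fin m → ℝ) × (Fin N → FlatState n p m₀ l) =>
      etaError P z.1 fun i => AgentState.ofFlat (z.2 i) :=
    continuous_pi fun i => (locallyLipschitz_η (locallyLipschitz_snd_apply i)).continuous.sub
      (Continuous.matrix_mulVec continuous_const continuous_fst)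
  obtain ⟨B', hB'⟩ := hcont.exists_bound_of_norm_le B
  refine tendsto_zero_of_mul_norm_sq_le hc (Eventually.of_forall fun t => hQ _) ?_
  have hterm : ∀ i k, Tendsto (fun t => etaError P (v t) (x t) i k *
      neighborError G 0 (etaError P (v t) (x t)) i k) atTop (𝓝 0) := by
    intro i k
    refine tendsto_zero_mul_of_bounded (B := B') ?_ ?_
    · filter_upwards [eventually_ge_atTop 0] with t ht
      exact (norm_le_pi_norm _ k).trans ((norm_le_pi_norm (etaError P (v t) (x t)) i).trans
        (hB' (flatCurve v x t) (hB t ht)))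
    · have h1 := tendsto_pi_nhds.1 (h.tendsto_neighborError hn hG hU hY i) k
      refine h1.congr fun t => ?_
      rw [neighborError_eq_sub_leader]
      rfl
  have hsum := (tendsto_finsetSum Finset.univ fun i _ =>
    tendsto_finsetSum Finset.univ fun k _ => hterm i k).neg
  simp only [Finset.sum_const_zero, neg_zero] at hsum
  exact hsum

/-- This is not a consequence of the convergence of `etaError` and of the neighbour errors alone,
since the frequency estimates need not converge to the true frequencies; it follows from Barbalat's
lemma. -/
theorem tendsto_etaErrorRate (h : IsForwardSolution G S C P R sys Y g v₀ x₀ (Ici 0) v x)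
    (hn : IsNormalForm S ω P R) (hG : HasLeaderSpanningTree G) (hU : FollowersUndirected G)
    (hY : ∀ i, IsRegressor (sys i) (Y i) (Θ i)) (i : Fin N) :
    Tendsto (fun t => etaErrorRate G P g.μ₁ ω (v t) (x t) i) atTop (𝓝 0) := by
  refine tendsto_pi_nhds.2 fun k => ?_
  have ha := locallyLipschitz_snd_apply (m := m) (n := n) (p := p) (m₀ := m₀) (l := l) i
  have hcont : Continuous fun z : (Fin m → ℝ) × (Fin N → FlatState n p m₀ l) =>
      etaErrorRate G P g.μ₁ ω z.1 (fun i => AgentState.ofFlat (z.2 i)) i :=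
    (locallyLipschitz_etaRate g.μ₁ (locallyLipschitz_η ha) (locallyLipschitz_ω ha)
      (locallyLipschitz_neighborError_snd G P i)).continuous.sub
      (Continuous.matrix_mulVec continuous_const
        (Continuous.matrix_mulVec continuous_const continuous_fst))
  exact h.tendsto_rate hn hG hU hY (φ := fun v x => etaErrorRate G P g.μ₁ ω v x i k)
    ((continuous_apply k).comp hcont)
    (fun t ht => hasDerivWithinAt_pi.1 (h.hasDerivWithinAt_etaError hn ht i) k)
    (tendsto_pi_nhds.1 (tendsto_pi_nhds.1 (h.tendsto_etaError hn hG hU hY) i) k)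

theorem tendsto_slide (h : IsForwardSolution G S C P R sys Y g v₀ x₀ (Ici 0) v x)
    (hn : IsNormalForm S ω P R) (hG : HasLeaderSpanningTree G) (hU : FollowersUndirected G)
    (hY : ∀ i, IsRegressor (sys i) (Y i) (Θ i)) (i : Fin N) :
    Tendsto (fun t => ControlLaw.slide (C * R) g.α (x t i)) atTop (𝓝 0) := by
  obtain ⟨c, hc⟩ := (antitoneOn_trackingEnergy h hY i).exists_tendsto_atTop_of_bddBelow (b := 0)
    fun t _ => by
      obtain ⟨c, c', hc, hc', hQ⟩ := exists_trackingEnergy_coercive sys g (C * R) Θ i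
      exact le_trans (by positivity) (hQ (x t))
  have hs := (locallyLipschitz_slide (locallyLipschitz_snd_apply (m := m) (n := n) (p := p)
    (m₀ := m₀) (l := l) i) (C * R) g.α).continuous
  have hlim := h.tendsto_rate hn hG hU hY
    (φ := fun _ x => -2 * (ControlLaw.slide (C * R) g.α (x i) ⬝ᵥ
      (g.K i *ᵥ ControlLaw.slide (C * R) g.α (x i))))
    (continuous_const.mul (hs.dotProduct (Continuous.matrix_mulVec continuous_const hs)))
    (fun t ht => h.hasDerivWithinAt_trackingEnergy hY ht i) hc
  obtain ⟨k, hk, hK⟩ := (g.K_pos i).exists_pos_mul_norm_sq_le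
  refine tendsto_zero_of_mul_norm_sq_le hk (Eventually.of_forall fun t => hK _) ?_
  simpa using hlim.const_mul (-2)⁻¹

/-- The input of the linear filter for the output error vanishes at infinity. -/
theorem tendsto_filterInput (h : IsForwardSolution G S C P R sys Y g v₀ x₀ (Ici 0) v x)
    (hn : IsNormalForm S ω P R) (hG : HasLeaderSpanningTree G) (hU : FollowersUndirected G)
    (hY : ∀ i, IsRegressor (sys i) (Y i) (Θ i)) (i : Fin N) :
    Tendsto (fun t => ControlLaw.slide (C * R) g.α (x t i) - g.μ₁ • ((C * R) *ᵥ
      neighborError G (P *ᵥ v t) (fun j => (x t j).η) i)) atTop (𝓝 0) := by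
  have hA : Continuous fun w : LeaderIdx m₀ l → ℝ => (C * R) *ᵥ w :=
    Continuous.matrix_mulVec continuous_const continuous_id
  have h1 := (hA.tendsto 0).comp (h.tendsto_neighborError hn hG hU hY i)
  rw [Matrix.mulVec_zero] at h1
  simpa using (h.tendsto_slide hn hG hU hY i).sub (h1.const_smul g.μ₁)

theorem tendsto_outputError (h : IsForwardSolution G S C P R sys Y g v₀ x₀ (Ici 0) v x)
    (hn : IsNormalForm S ω P R) (hG : HasLeaderSpanningTree G) (hU : FollowersUndirected G)
    (hY : ∀ i, IsRegressor (sys i) (Y i) (Θ i)) (i : Fin N) :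
    Tendsto (fun t => (x t i).q - (C * R) *ᵥ (x t i).η) atTop (𝓝 0) :=
  tendsto_pi_nhds.2 fun k => tendsto_zero_of_hasDerivWithinAt_linear g.α_pos
    (fun _ ht => hasDerivWithinAt_pi.1 (h.hasDerivWithinAt_outputError ht i) k)
    (tendsto_pi_nhds.1 (h.tendsto_filterInput hn hG hU hY i) k)

theorem tendsto_position (h : IsForwardSolution G S C P R sys Y g v₀ x₀ (Ici 0) v x)
    (hn : IsNormalForm S ω P R) (hG : HasLeaderSpanningTree G) (hU : FollowersUndirected G)
    (hY : ∀ i, IsRegressor (sys i) (Y i) (Θ i)) (i : Fin N) :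
    Tendsto (fun t => (x t i).q - C *ᵥ v t) atTop (𝓝 0) := by
  have hA : Continuous fun w : LeaderIdx m₀ l → ℝ => (C * R) *ᵥ w :=
    Continuous.matrix_mulVec continuous_const continuous_id
  have h1 := (hA.tendsto 0).comp (tendsto_pi_nhds.1 (h.tendsto_etaError hn hG hU hY) i)
  rw [Matrix.mulVec_zero] at h1
  have h2 := (h.tendsto_outputError hn hG hU hY i).add h1
  rw [add_zero] at h2
  refine h2.congr fun t => ?_
  simp only [Function.comp_apply, etaError, Matrix.mulVec_sub]
  rw [← Matrix.mulVec_mulVec (P *ᵥ v t), hn.mulVec_mulVec_self]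
  abel

theorem tendsto_velocity (h : IsForwardSolution G S C P R sys Y g v₀ x₀ (Ici 0) v x)
    (hn : IsNormalForm S ω P R) (hG : HasLeaderSpanningTree G) (hU : FollowersUndirected G)
    (hY : ∀ i, IsRegressor (sys i) (Y i) (Θ i)) (i : Fin N) :
    Tendsto (fun t => (x t i).dq - deriv (fun s => C *ᵥ v s) t) atTop (𝓝 0) := by
  have hA : Continuous fun w : LeaderIdx m₀ l → ℝ => (C * R) *ᵥ w :=
    Continuous.matrix_mulVec continuous_const continuous_id
  have h1 := (hA.tendsto 0).comp (h.tendsto_etaErrorRate hn hG hU hY i)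
  rw [Matrix.mulVec_zero] at h1
  have h2 := (((h.tendsto_outputError hn hG hU hY i).const_smul (-g.α)).add
    (h.tendsto_filterInput hn hG hU hY i)).add h1
  rw [smul_zero, add_zero, add_zero] at h2
  refine h2.congr' ?_
  filter_upwards [eventually_gt_atTop 0] with t ht
  have hd : deriv (fun s => C *ᵥ v s) t = C *ᵥ (S *ᵥ v t) :=
    (((h.leader t (mem_Ici.2 ht.le)).const_mulVec C).hasDerivAt (Ici_mem_nhds ht)).deriv
  have hCS : C *ᵥ (S *ᵥ v t) = (C * R) *ᵥ (leaderMatrix m₀ ω *ᵥ (P *ᵥ v t)) := by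
    rw [← hn.mul_mulVec, ← Matrix.mulVec_mulVec (P *ᵥ (S *ᵥ v t)), hn.mulVec_mulVec_self]
  rw [← outputErrorRate_eq, hd, hCS]
  simp only [Function.comp_apply, etaErrorRate, Matrix.mulVec_sub]
  abel

theorem exists_bound_torque (h : IsForwardSolution G S C P R sys Y g v₀ x₀ (Ici 0) v x)
    (hn : IsNormalForm S ω P R) (hG : HasLeaderSpanningTree G) (hU : FollowersUndirected G)
    (hY : ∀ i, IsRegressor (sys i) (Y i) (Θ i)) (i : Fin N) :
    BoundedOnHalfLine (fun t => ControlLaw.torque g i (Y i) (C * R) (x t i)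
      (neighborError G (P *ᵥ v t) (fun j => (x t j).η) i)) := by
  obtain ⟨B, hB⟩ := h.exists_bound hn hG hU hY
  have ha := locallyLipschitz_snd_apply (m := m) (n := n) (p := p) (m₀ := m₀) (l := l) i
  have he := locallyLipschitz_neighborError_snd (n := n) (p := p) G P i
  have hcont := (locallyLipschitz_torque ha he (hY i) (C * R) g i).continuous
  obtain ⟨B', hB'⟩ := hcont.exists_bound_of_norm_le B
  exact ⟨B', fun t ht => hB' (flatCurve v x t) (hB t ht)⟩

end IsForwardSolution

theorem mainTheorem1 {N n m p : ℕ}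
    (G : Digraph (Fin (N + 1))) (hG : HasLeaderSpanningTree G) (hU : FollowersUndirected G)
    (S : Matrix (Fin m) (Fin m) ℝ) (hS : NeutrallyStable S) (C : Matrix (Fin n) (Fin m) ℝ)
    (sys : Fin N → EulerLagrangeSystem n) (Y : Fin N → RegressorFun n p)
    (Θ : Fin N → Fin p → ℝ) (hY : ∀ i, IsRegressor (sys i) (Y i) (Θ i)) :
    -- coordinates in which the leader has the form used by the control law exist
    (∃ (m₀ l : ℕ) (ω : Fin l → ℝ) (P : Matrix (LeaderIdx m₀ l) (Fin m) ℝ)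
        (R : Matrix (Fin m) (LeaderIdx m₀ l) ℝ),
        (∀ k, 0 < ω k) ∧ IsNormalForm S ω P R) ∧
    -- and in all such coordinates the control law solves the consensus problem
    ∀ (m₀ l : ℕ) (ω : Fin l → ℝ) (P : Matrix (LeaderIdx m₀ l) (Fin m) ℝ)
      (R : Matrix (Fin m) (LeaderIdx m₀ l) ℝ), IsNormalForm S ω P R →
      ∀ (g : Gains N n p) (v₀ : Fin m → ℝ) (x₀ : Fin N → AgentState n p m₀ l),
        ∃ (v : ℝ → Fin m → ℝ) (x : ℝ → Fin N → AgentState n p m₀ l),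
          v 0 = v₀ ∧ x 0 = x₀ ∧
          IsClosedLoopSolution G S C P R sys Y g (Ici 0) v x ∧
          -- it is the only solution: every solution on some `[0, T)` is its restriction
          (∀ T : ℝ, 0 < T → ∀ (v' : ℝ → Fin m → ℝ) (x' : ℝ → Fin N → AgentState n p m₀ l),
            v' 0 = v₀ → x' 0 = x₀ →
            IsClosedLoopSolution G S C P R sys Y g (Ico 0 T) v' x' →
            ∀ t ∈ Ico (0 : ℝ) T, v' t = v t ∧ x' t = x t) ∧
          BoundedOnHalfLine v ∧
          (∀ i : Fin N,
            BoundedOnHalfLine (fun t => (x t i).q) ∧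
            BoundedOnHalfLine (fun t => (x t i).dq) ∧
            BoundedOnHalfLine (fun t => (x t i).Θhat) ∧
            BoundedOnHalfLine (fun t => (x t i).η) ∧
            BoundedOnHalfLine (fun t => (x t i).ω) ∧
            BoundedOnHalfLine (fun t => ControlLaw.torque g i (Y i) (C * R) (x t i)
              (neighborError G (P *ᵥ v t) (fun j => (x t j).η) i)) ∧
            Tendsto (fun t => (x t i).q - C *ᵥ v t) atTop (𝓝 0) ∧
            Tendsto (fun t => (x t i).dq - deriv (fun s => C *ᵥ v s) t) atTop (𝓝 0)) := by
  refine ⟨hS.exists_isNormalForm, fun m₀ l ω P R hn g v₀ x₀ => ?_⟩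
  obtain ⟨v, x, h⟩ := exists_solution_Ici (C := C) (g := g) hn hG hU hY v₀ x₀
  obtain ⟨B, hB⟩ := h.exists_bound hn hG hU hY
  have hagent := fun (i : Fin N) (t : ℝ) (ht : 0 ≤ t) => AgentState.norm_toFlat_le_iff.1
    ((norm_le_pi_norm (flatCurve v x t).2 i).trans ((norm_snd_le _).trans (hB t ht)))
  refine ⟨v, x, h.leader_init, h.agents_init, h.toIsClosedLoopSolution,
    fun T _ v' x' hv' hx' h' t ht => h'.eqOn hY (h.toIsClosedLoopSolution.mono Ico_subset_Ici_self)
      (hv'.trans h.leader_init.symm) (hx'.trans h.agents_init.symm) ht,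
    ⟨B, fun t ht => (norm_fst_le _).trans (hB t ht)⟩, fun i => ⟨⟨B, fun t ht => (hagent i t ht).1⟩,
      ⟨B, fun t ht => (hagent i t ht).2.1⟩, ⟨B, fun t ht => (hagent i t ht).2.2.1⟩,
      ⟨B, fun t ht => (hagent i t ht).2.2.2.1⟩, ⟨B, fun t ht => (hagent i t ht).2.2.2.2⟩,
      h.exists_bound_torque hn hG hU hY i, h.tendsto_position hn hG hU hY i,
      h.tendsto_velocity hn hG hU hY i⟩⟩
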